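/- Fix an integer $d\ge 1$. For each $n$, let $\mathcal K_n^d$ be the complete $d$-skeleton on $n$ vertices (all non-empty vertex sets with at most $d+1$ elements; an $i$-face is a set of $i+1$ vertices), and let the uniformly weighted $d$-complex $\mathcal U_{n,d}$ be $\mathcal K_n^d$ with a random weight function $w=w_n$ that is $0$ on all faces of dimension less than $d$ and whose values on the $d$-faces are i.i.d. uniform random variables on $[0,1]$. For a $(d-1)$-face $\sigma$ and $n\ge d+1$ let $$C(\sigma)=\min\{w(\tau):\ \tau \text{ a } d\text{-face},\ \tau\supset\sigma\},\qquad \bar C(\sigma)=n\,C(\sigma)-d\log n+\log(d!),$$ and consider the point process on $\mathbb R$ $$\mathscr P^{C}_{n,d}(R)=\bigl|\{\sigma \text{ a } (d-1)\text{-face of } \mathcal U_{n,d}:\ \bar C(\sigma)\in R\}\bigr|,\qquad R\subseteq\mathbb R \text{ Borel}.$$ Let $M_p(\mathbb R)$ be the set of locally finite Borel measures on $\mathbb R$ with values in $\{0,1,2,\dots\}\cup\{\infty\}$, with the vague topology (the coarsest topology for which $m\mapsto\int f\,dm$ is continuous for every continuous, compactly supported $f\ge 0$) and its Borel $\sigma$-algebra.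 A Poisson point process with intensity $e^{-x}\,dx$ is a random element $\mathscr P_{\mathrm{poi}}$ of $M_p(\mathbb R)$ such that $\mathscr P_{\mathrm{poi}}(A_1),\dots,\mathscr P_{\mathrm{poi}}(A_m)$ are independent for all disjoint Borel sets $A_1,\dots,A_m$, and $\mathscr P_{\mathrm{poi}}(A)$ is Poisson with mean $\int_A e^{-x}\,dx$ for every Borel set $A$ (almost surely infinite if this mean is infinite). **Theorem.** Such a Poisson point process $\mathscr P_{\mathrm{poi}}$ exists, and as $n\to\infty$, $\mathscr P^{C}_{n,d}$ converges in distribution to $\mathscr P_{\mathrm{poi}}$ in $M_p(\mathbb R)$; that is, $\mathbb E[F(\mathscr P^{C}_{n,d})]\to\mathbb E[F(\mathscr P_{\mathrm{poi}})]$ for every bounded continuous $F:M_p(\mathbb R)\to\mathbb R$. -/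

import Mathlib

open MeasureTheory ProbabilityTheory Filter Topology
open scoped ENNReal NNReal CompactlySupported

/-- The space `M_p(ℝ)` of point measures on `ℝ`: locally finite (Radon) Borel measures all of whose
values lie in `{0, 1, 2, …} ∪ {∞}`. -/
@[ext]
structure PointMeasure where
  /-- The underlying Borel measure. -/
  toMeasure : Measure ℝ
  locallyFinite : IsLocallyFiniteMeasure toMeasure
  integerValued : ∀ A : Set ℝ, MeasurableSet A → ∃ k : ℕ∞, toMeasure A = (k : ℝ≥0∞)

namespace PointMeasure

/-- `m(f) = ∫ f dm` for `f` continuous, non-negative, with compact support. -/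
noncomputable def eval (m : PointMeasure) (f : C_c(ℝ, ℝ≥0)) : ℝ :=
  ∫ x, (f x : ℝ) ∂m.toMeasure

/-- The vague topology on `M_p(ℝ)`: the coarsest topology making `m ↦ m(f)` continuous for every
`f ∈ C_c⁺(ℝ)`, i.e. with sub-base the sets `{m : m(f) ∈ (s, t)}`. -/
noncomputable instance : TopologicalSpace PointMeasure :=
  TopologicalSpace.induced PointMeasure.eval Pi.topologicalSpace

/-- The Borel σ-algebra of the vague topology. -/
noncomputable instance : MeasurableSpace PointMeasure := borel PointMeasure

instance : BorelSpace PointMeasure := ⟨rfl⟩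

/-- The point measure `∑ i, δ_{x i}` of a finite family of real points, counted with multiplicity. -/
noncomputable def ofFamily {ι : Type*} [Finite ι] (x : ι → ℝ) : PointMeasure where
  toMeasure := Measure.sum fun i => Measure.dirac (x i)
  locallyFinite := by
    have : Fintype ι := Fintype.ofFinite ι
    rw [Measure.sum_fintype]
    infer_instance
  integerValued A hA := by
    classical
    refine ⟨∑' i, if x i ∈ A then 1 else 0, ?_⟩
    have : Fintype ι := Fintype.ofFinite ι
    rw [Measure.sum_apply _ hA, tsum_fintype, tsum_fintype]
    rw [← ENat.toENNRealRingHom_apply, map_sum]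
    refine Finset.sum_congr rfl fun i _ => ?_
    by_cases h : x i ∈ A <;> simp [hA, h]

end PointMeasure

/-- The Poisson law with mean `r ∈ [0, ∞]`, as a measure on `[0, ∞]`. As usual, a Poisson variable
with infinite mean is almost surely equal to `∞`. -/
noncomputable def poissonLaw (r : ℝ≥0∞) : Measure ℝ≥0∞ :=
  open Classical in
  if r = ∞ then Measure.dirac ∞ else (poissonMeasure r.toNNReal).map (fun k : ℕ => (k : ℝ≥0∞))

/-- `P` is a Poisson point process on `ℝ` with intensity function `h` (a non-negative, locally
integrable function): `P` is a random element of `M_p(ℝ)`, the numbers of points in disjoint Borel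
sets are independent, and the number of points in a Borel set `A` is Poisson with mean
`∫_A h(x) dx`. -/
structure IsPoissonPointProcess {Ω : Type*} [MeasurableSpace Ω] (P : Ω → PointMeasure)
    (μ : Measure Ω) (h : ℝ → ℝ) : Prop where
  measurable : Measurable P
  indep : ∀ (m : ℕ) (A : Fin m → Set ℝ), (∀ i, MeasurableSet (A i)) →
    Pairwise (Function.onFun Disjoint A) → iIndepFun (fun i ω => (P ω).toMeasure (A i)) μ
  poisson : ∀ A : Set ℝ, MeasurableSet A →
    μ.map (fun ω => (P ω).toMeasure A) = poissonLaw (∫⁻ x in A, ENNReal.ofReal (h x))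

/-- The complete `d`-skeleton on `n` vertices: all non-empty sets of at most `d + 1` vertices. -/
def completeSkeleton (n d : ℕ) : PreAbstractSimplicialComplex (Fin n) where
  faces := {σ | σ.Nonempty ∧ σ.card ≤ d + 1}
  isRelLowerSet_faces := fun _ h =>
    ⟨h.1, fun _ hts ht => ⟨ht, (Finset.card_le_card hts).trans h.2⟩⟩

/-- The set of `i`-dimensional faces of a simplicial complex `K`. -/
abbrev Face {V : Type*} (K : PreAbstractSimplicialComplex V) (i : ℕ) : Type _ :=
  {σ : K // σ.1.card = i + 1}

/-- `w` is the (random) weight function of the uniformly weighted `d`-complex on `n` vertices: it is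
zero on all faces of dimension less than `d`, and its values on the `d`-faces are i.i.d. uniform
random variables on `[0, 1]`. -/
structure IsUniformlyWeighted {Ω : Type*} [MeasurableSpace Ω] (n d : ℕ)
    (w : completeSkeleton n d → Ω → ℝ) (μ : Measure Ω) : Prop where
  eq_zero : ∀ σ : completeSkeleton n d, σ.1.card ≤ d → ∀ ω, w σ ω = 0
  measurable : ∀ τ : Face (completeSkeleton n d) d, Measurable (w τ.1)
  uniform : ∀ τ : Face (completeSkeleton n d) d, pdf.IsUniform (w τ.1) (Set.Icc 0 1) μ volume
  indep : iIndepFun (fun τ : Face (completeSkeleton n d) d => w τ.1) μ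

/-- The nearest-face distance `C(σ)`: the least weight of a `d`-face containing the `(d-1)`-face `σ`
(an infimum over a finite set, which is non-empty as soon as `n ≥ d + 1`). -/
noncomputable def nearestFaceDist {n d : ℕ} (w : completeSkeleton n d → ℝ)
    (σ : Face (completeSkeleton n d) (d - 1)) : ℝ :=
  ⨅ τ : {τ : Face (completeSkeleton n d) d // σ.1.1 ⊆ τ.1.1}, w τ.1.1

/-- The scaled point process of nearest-face distances: it has a point at
`n C(σ) - d log n + log (d!)` for each `(d-1)`-face `σ`, counted with multiplicity. -/
noncomputable def nearestFaceProcess {n d : ℕ} (w : completeSkeleton n d → ℝ) : PointMeasure :=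
  PointMeasure.ofFamily fun σ : Face (completeSkeleton n d) (d - 1) =>
    (n : ℝ) * nearestFaceDist w σ - d * Real.log n + Real.log (d.factorial : ℝ)

/-! The centring is chosen so that a fixed `(d-1)`-face `σ` has scaled distance above `y` with
probability about `(1 - (y + d log n - log d!)/n)^n`, which is asymptotic to `d! e^{-y} / n^d`.
There are about `n^d / d!` such faces, so the mean number of points above `y` tends to `e^{-y}`
(`tendsto_pow_mul_one_sub_pow`, `tendsto_choose_choose_div_pow`).

Two distinct `(d-1)`-faces have at most one common coface (`card_cofaces_inter_le_one`). Hence the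
minima over any `k` stars are minima over disjoint, independent blocks, up to an error that stays
negligible when summed over all `k`-sets of faces (`norm_integral_prod_minOver_sub_le`). For `g`
continuous with compact support, the expected `k`-th elementary symmetric sum of the values
`g(point)` therefore tends to `J^k / k!` with `J = ∫ e^{-y} g(y) dy`
(`tendsto_integral_sum_powersetCard`).

With `g = e^{if} - 1`, the variable `exp(i ∫ f dP_n)` is the product of `1 + g` over the points.
Expanding it and truncating by a Bonferroni bound (`norm_prod_one_add_sub_le`) gives the limit
`exp(J)`, which is the characteristic functional of the Poisson process
(`IsPoissonPointProcess.integral_exp_integral`). This suffices for convergence in law, because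
countably many maps `m ↦ ∫ f dm` induce the vague topology (`isInducing_testFun`,
`tendsto_of_tendsto_charFun_marginals`).

The Poisson process is built by superposing independent finite Poisson samples on bounded pieces of
the line. It is recognised by its Laplace functional, since Laplace transforms determine laws on
`[0, ∞]^m` (`ext_of_lintegral_negExp`). Working with `negExp` on `[0, ∞]` allows infinite counts and
avoids integrability conditions. -/

namespace PointMeasure

/-! ### The vague topology and its Borel σ-algebra. -/

instance (m : PointMeasure) : IsLocallyFiniteMeasure m.toMeasure := m.locallyFinite

lemma integrable_coe (m : PointMeasure) (f : C_c(ℝ, ℝ≥0)) :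
    Integrable (fun x => (f x : ℝ)) m.toMeasure := by
  refine Continuous.integrable_of_hasCompactSupport (by fun_prop) ?_
  exact f.hasCompactSupport.comp_left (g := fun y : ℝ≥0 => (y : ℝ)) (by simp)

/-- The continuous non-negative functions vanishing outside `(-K, K)`. -/
def vanishing (K : ℕ) : Set C(ℝ, ℝ≥0) := {f | ∀ x, (K : ℝ) ≤ |x| → f x = 0}

/-- A continuous non-negative function vanishing outside `(-K, K)`, as an element of `C_c⁺(ℝ)`. -/
noncomputable def ofVanishing {K : ℕ} (f : vanishing K) :
    C_c(ℝ, ℝ≥0) :=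
  ⟨f.1, HasCompactSupport.intro (isCompact_Icc (a := -(K : ℝ)) (b := K)) fun x hx => f.2 x (by
    by_contra h
    exact hx ⟨by linarith [neg_abs_le x], by linarith [le_abs_self x]⟩)⟩

/-- A continuous function with values in `[0, 1]`, equal to `1` on `[-K, K]` and with support in
`[-(K+1), K+1]`. -/
noncomputable def plateau (K : ℕ) : C_c(ℝ, ℝ≥0) :=
  ⟨⟨fun x => Real.toNNReal (min 1 (K + 1 - |x|)), by fun_prop⟩,
    HasCompactSupport.intro (isCompact_Icc (a := -((K : ℝ) + 1)) (b := K + 1)) fun x hx => by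
      have : (K : ℝ) + 1 ≤ |x| := by
        by_contra h
        exact hx ⟨by linarith [neg_abs_le x], by linarith [le_abs_self x]⟩
      exact Real.toNNReal_of_nonpos ((min_le_right _ _).trans (by linarith))⟩

lemma plateau_apply (K : ℕ) (x : ℝ) :
    plateau K x = Real.toNNReal (min 1 (K + 1 - |x|)) := rfl

lemma plateau_eq_one {K : ℕ} {x : ℝ} (hx : |x| ≤ K) : plateau K x = 1 := by
  rw [plateau_apply, min_eq_left (by linarith)]; simp

instance (K : ℕ) : Nonempty (vanishing K) :=
  ⟨⟨0, fun _ _ => rfl⟩⟩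

/-- A countable family of test functions that determines the vague topology. -/
noncomputable def testFun : (ℕ × ℕ) ⊕ ℕ → C_c(ℝ, ℝ≥0)
  | .inl (K, n) => ofVanishing (TopologicalSpace.denseSeq (vanishing K) n)
  | .inr K => plateau K

/-- Near a function supported in `(-K, K)`, compact-open approximation is uniform approximation on
`[-K, K]`. The error is measured against `plateau K` so that it can be integrated against an
infinite measure, and `K` does not depend on `ε`, so the mass of the plateau is known before `ε` is
chosen. -/
lemma exists_testFun_near (f : C_c(ℝ, ℝ≥0)) :
    ∃ K : ℕ, ∀ ε > 0, ∃ i, ∀ x, dist (f x) (testFun i x) ≤ ε * plateau K x := by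
  obtain ⟨R, hR⟩ := f.hasCompactSupport.isCompact.isBounded.subset_closedBall 0
  obtain ⟨K, hK⟩ := exists_nat_gt R
  refine ⟨K, fun ε hε => ?_⟩
  have hf : ∀ x, (K : ℝ) ≤ |x| → f x = 0 := fun x hx => by
    by_contra h
    have := hR (subset_tsupport _ (Function.mem_support.2 h))
    simp at this
    linarith
  let f' : vanishing K := ⟨f.toContinuousMap, hf⟩
  have hU : ∀ᶠ g : vanishing K in 𝓝 f', ∀ x ∈ Set.Icc (-(K : ℝ)) K, dist (f x) (g.1 x) < ε := by
    have h1 := (ContinuousMap.tendsto_iff_forall_isCompact_tendstoUniformlyOn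
      (F := fun g : vanishing K => g.1) (f := f'.1)).1
      (continuous_subtype_val.tendsto f') (Set.Icc (-(K : ℝ)) K) isCompact_Icc
    exact Metric.tendstoUniformlyOn_iff.1 h1 ε hε
  obtain ⟨_, ⟨n, rfl⟩, hn⟩ :=
    (TopologicalSpace.denseRange_denseSeq (vanishing K)).inter_nhds_nonempty hU
  refine ⟨.inl (K, n), fun x => ?_⟩
  rcases le_total |x| K with hx | hx
  · rw [plateau_eq_one hx]
    exact (hn x ⟨by linarith [neg_abs_le x], by linarith [le_abs_self x]⟩).le.trans (by simp)
  · have h2 : testFun (.inl (K, n)) x = 0 :=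
      (TopologicalSpace.denseSeq (vanishing K) n).2 x hx
    rw [hf x hx, h2, dist_self]
    positivity

/-- The mass of the plateau is locally bounded, so integrals of `f` are locally uniform limits of
integrals of test functions. The map `e` leaves the topology of the source free: the lemma is used
with `e = id` and a topology on `PointMeasure` not yet known to be the vague one. -/
lemma continuous_eval_of_testFun {X : Type*} [TopologicalSpace X] (e : X → PointMeasure)
    (h : ∀ i, Continuous fun x => (e x).eval (testFun i)) (f : C_c(ℝ, ℝ≥0)) :
    Continuous fun x => (e x).eval f := by
  obtain ⟨K, hK⟩ := exists_testFun_near f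
  refine continuous_of_locally_uniform_approx_of_continuousAt fun x u hu => ?_
  obtain ⟨ε, hε, hεu⟩ := Metric.mem_uniformity_dist.1 hu
  set c := (e x).eval (plateau K)
  have hc : 0 ≤ c := integral_nonneg fun _ => NNReal.coe_nonneg _
  -- The plateau has mass below `c + 1` on the neighbourhood used, so this tolerance makes the total
  -- error less than `ε / 2`.
  obtain ⟨i, hi⟩ := hK (ε / (2 * (c + 1))) (by positivity)
  refine ⟨{y | (e y).eval (plateau K) < c + 1},
    (isOpen_lt (h (.inr K)) continuous_const).mem_nhds (by simp [c, testFun]),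
    fun y => (e y).eval (testFun i), (h i).continuousAt, fun y hy => hεu ?_⟩
  have hy' : (e y).eval (plateau K) < c + 1 := hy
  calc dist ((e y).eval f) ((e y).eval (testFun i))
      = ‖∫ x, ((f x : ℝ) - testFun i x) ∂(e y).toMeasure‖ := by
        rw [dist_eq_norm, eval, eval, integral_sub (integrable_coe _ _) (integrable_coe _ _)]
    _ ≤ ∫ x, ε / (2 * (c + 1)) * plateau K x ∂(e y).toMeasure := by
        refine norm_integral_le_of_norm_le ((integrable_coe _ _).const_mul _)
          (.of_forall fun x => ?_)
        exact hi x
    _ = ε / (2 * (c + 1)) * (e y).eval (plateau K) := integral_const_mul _ _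
    _ ≤ ε / (2 * (c + 1)) * (c + 1) := by gcongr
    _ < ε := by field_simp; linarith

lemma topology_eq_induced_testFun :
    (inferInstance : TopologicalSpace PointMeasure) =
      TopologicalSpace.induced (fun m i => m.eval (testFun i)) Pi.topologicalSpace := by
  refine le_antisymm ?_ ?_
  · rw [← continuous_iff_le_induced]
    have : Continuous (PointMeasure.eval) := continuous_induced_dom
    exact continuous_pi fun i => (continuous_apply (testFun i)).comp this
  · refine continuous_iff_le_induced.1 ?_
    let _ : TopologicalSpace PointMeasure :=
      TopologicalSpace.induced (fun m i => m.eval (testFun i)) Pi.topologicalSpace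
    refine continuous_pi fun f => ?_
    refine continuous_eval_of_testFun id (fun i => ?_) f
    have : Continuous (fun (m : PointMeasure) i => m.eval (testFun i)) := continuous_induced_dom
    exact (continuous_apply i).comp this

lemma isInducing_testFun : IsInducing (fun (m : PointMeasure) i => m.eval (testFun i)) :=
  ⟨topology_eq_induced_testFun⟩

lemma continuous_eval (f : C_c(ℝ, ℝ≥0)) : Continuous fun m : PointMeasure => m.eval f := by
  have : Continuous (PointMeasure.eval) := continuous_induced_dom
  exact (continuous_apply f).comp this

/-- Countability of the index set is essential: it makes the Borel σ-algebra of the product equal to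
the product σ-algebra. -/
lemma measurable_of_measurable_eval {Ω : Type*} [MeasurableSpace Ω] {P : Ω → PointMeasure}
    (h : ∀ i, Measurable fun ω => (P ω).eval (testFun i)) : Measurable P := by
  have : borel PointMeasure =
      MeasurableSpace.comap (fun m i => m.eval (testFun i)) MeasurableSpace.pi := by
    rw [isInducing_testFun.eq_induced, borel_comap, ← BorelSpace.measurable_eq]
  change @Measurable _ _ _ (borel PointMeasure) P
  rw [this, measurable_comap_iff]
  exact measurable_pi_lambda _ h

lemma eval_eq_toReal (m : PointMeasure) (f : C_c(ℝ, ℝ≥0)) :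
    m.eval f = (∫⁻ x, f x ∂m.toMeasure).toReal := by
  rw [eval, integral_eq_lintegral_of_nonneg_ae (.of_forall fun _ => NNReal.coe_nonneg _)]
  · simp
  · exact (integrable_coe m f).aestronglyMeasurable

lemma measurable_of_measurable_toMeasure {Ω : Type*} [MeasurableSpace Ω] {P : Ω → PointMeasure}
    (h : Measurable fun ω => (P ω).toMeasure) : Measurable P := by
  refine measurable_of_measurable_eval fun i => ?_
  simp_rw [eval_eq_toReal]
  exact ((Measure.measurable_lintegral (by fun_prop)).comp h).ennreal_toReal

lemma measurable_lintegral_coe (f : C_c(ℝ, ℝ≥0)) :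
    Measurable fun m : PointMeasure => ∫⁻ x, f x ∂m.toMeasure := by
  have : (fun m : PointMeasure => ∫⁻ x, f x ∂m.toMeasure) =
      fun m => ENNReal.ofReal (m.eval f) := by
    ext m
    rw [eval_eq_toReal, ENNReal.ofReal_toReal]
    have := (integrable_coe m f).lintegral_lt_top
    simpa using this.ne
  rw [this]
  exact (continuous_eval f).measurable.ennreal_ofReal

/-- A continuous approximation from below of the indicator of `(a, b)`. -/
noncomputable def innerApprox (a b : ℝ) (n : ℕ) : C_c(ℝ, ℝ≥0) :=
  ⟨⟨fun x => Real.toNNReal (min 1 (n * min (x - a) (b - x))), by fun_prop⟩,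
    HasCompactSupport.intro (isCompact_Icc (a := a) (b := b)) fun x hx => by
      have : min (x - a) (b - x) ≤ 0 := by
        by_contra! h
        rw [lt_min_iff] at h
        exact hx ⟨by linarith, by linarith⟩
      exact Real.toNNReal_of_nonpos ((min_le_right _ _).trans
        (mul_nonpos_of_nonneg_of_nonpos (by positivity) this))⟩

lemma innerApprox_apply (a b : ℝ) (n : ℕ) (x : ℝ) :
    innerApprox a b n x = Real.toNNReal (min 1 (n * min (x - a) (b - x))) := rfl

lemma tendsto_innerApprox (a b x : ℝ) :
    Tendsto (fun n => (innerApprox a b n x : ℝ≥0∞)) atTop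
      (𝓝 ((Set.Ioo a b).indicator (fun _ => 1) x)) := by
  by_cases hx : x ∈ Set.Ioo a b
  · rw [Set.indicator_of_mem hx]
    have h0 : 0 < min (x - a) (b - x) := lt_min (by linarith [hx.1]) (by linarith [hx.2])
    refine tendsto_const_nhds.congr' ?_
    filter_upwards [(tendsto_natCast_atTop_atTop (R := ℝ)).eventually_ge_atTop
      (1 / min (x - a) (b - x))] with n hn
    rw [innerApprox_apply, min_eq_left]
    · simp
    · rwa [div_le_iff₀ h0] at hn
  · rw [Set.indicator_of_notMem hx]
    have h0 : min (x - a) (b - x) ≤ 0 := by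
      by_contra! h
      rw [lt_min_iff] at h
      exact hx ⟨by linarith, by linarith⟩
    refine tendsto_const_nhds.congr fun n => ?_
    rw [innerApprox_apply, Real.toNNReal_of_nonpos]
    · simp
    · exact (min_le_right _ _).trans (mul_nonpos_of_nonneg_of_nonpos (by positivity) h0)

lemma monotone_innerApprox (a b x : ℝ) : Monotone fun n => (innerApprox a b n x : ℝ≥0∞) := by
  by_cases hx : x ∈ Set.Ioo a b
  · intro n n' h
    simp only [innerApprox_apply]
    have h0 : 0 < min (x - a) (b - x) := lt_min (by linarith [hx.1]) (by linarith [hx.2])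
    gcongr
  · have h0 : min (x - a) (b - x) ≤ 0 := by
      by_contra! h
      rw [lt_min_iff] at h
      exact hx ⟨by linarith, by linarith⟩
    intro n n' _
    have : ∀ n, innerApprox a b n x = 0 := fun n => by
      rw [innerApprox_apply, Real.toNNReal_of_nonpos]
      exact (min_le_right _ _).trans (mul_nonpos_of_nonneg_of_nonpos (by positivity) h0)
    simp [this]

lemma measurable_toMeasure_Ioo (a b : ℝ) :
    Measurable fun m : PointMeasure => m.toMeasure (Set.Ioo a b) := by
  refine measurable_of_tendsto_metrizable (fun n => measurable_lintegral_coe (innerApprox a b n))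
    (tendsto_pi_nhds.2 fun m => ?_)
  rw [← lintegral_indicator_one measurableSet_Ioo]
  exact lintegral_tendsto_of_tendsto_of_monotone
    (fun n => (by fun_prop : Measurable _).aemeasurable)
    (.of_forall (monotone_innerApprox a b)) (.of_forall (tendsto_innerApprox a b))

/-- The counting maps `m ↦ m(A)` are measurable for the Borel σ-algebra of the vague topology. -/
lemma measurable_toMeasure : Measurable PointMeasure.toMeasure := by
  -- The restrictions to bounded windows are finite measures, so measurability extends from the
  -- π-system of rational intervals to all Borel sets.
  have key (N : ℕ) : Measurable fun m : PointMeasure =>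
      m.toMeasure.restrict (Set.Ioo (-(N : ℝ)) N) := by
    have (m : PointMeasure) : IsFiniteMeasure (m.toMeasure.restrict (Set.Ioo (-(N : ℝ)) N)) :=
      ⟨by
        rw [Measure.restrict_apply_univ]
        exact (measure_mono Set.Ioo_subset_Icc_self).trans_lt isCompact_Icc.measure_lt_top⟩
    refine Measurable.measure_of_isPiSystem
      (S := ⋃ (a : ℚ) (b : ℚ) (_ : a < b), {Set.Ioo (a : ℝ) b}) ?_ ?_ ?_ ?_
    · exact (BorelSpace.measurable_eq (α := ℝ)).trans (Real.borel_eq_generateFrom_Ioo_rat)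
    · exact Real.isPiSystem_Ioo_rat
    · intro s hs
      simp only [Set.mem_iUnion, Set.mem_singleton_iff] at hs
      obtain ⟨l, u, -, rfl⟩ := hs
      simp_rw [Measure.restrict_apply measurableSet_Ioo, Set.Ioo_inter_Ioo]
      exact measurable_toMeasure_Ioo _ _
    · simp_rw [Measure.restrict_apply_univ]
      exact measurable_toMeasure_Ioo _ _
  refine Measure.measurable_of_measurable_coe _ fun A hA => ?_
  have h (m : PointMeasure) :
      m.toMeasure A = ⨆ N : ℕ, m.toMeasure.restrict (Set.Ioo (-(N : ℝ)) N) A := by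
    simp_rw [Measure.restrict_apply hA]
    rw [← Monotone.measure_iUnion]
    · congr 1
      ext x
      simp only [Set.mem_iUnion, Set.mem_inter_iff, Set.mem_Ioo]
      obtain ⟨N, hN⟩ := exists_nat_gt |x|
      exact ⟨fun hx => ⟨N, hx, abs_lt.1 hN⟩, fun ⟨_, h, _⟩ => h⟩
    · intro i j hij
      have : (i : ℝ) ≤ j := by exact_mod_cast hij
      dsimp only
      gcongr
  simp_rw [h]
  exact .iSup fun N => (Measure.measurable_coe hA).comp (key N)

end PointMeasure


/-! ### Weak convergence from characteristic functionals. -/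

/-- On a space whose topology is induced by countably many real functions, weak convergence of
probability measures follows from convergence of the joint characteristic functions of finitely
many of these functions. -/
lemma tendsto_of_tendsto_charFun_marginals {E ι : Type*} [TopologicalSpace E] [MeasurableSpace E]
    [BorelSpace E] [Countable ι] {φ : E → ι → ℝ} (hφ : IsInducing φ)
    {μs : ℕ → ProbabilityMeasure E} {μ : ProbabilityMeasure E}
    (h : ∀ (s : Finset ι) (t : s → ℝ),
      Tendsto (fun n => ∫ x, Complex.exp ((∑ i : s, t i * φ x i : ℝ) * Complex.I)
          ∂(μs n : Measure E)) atTop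
        (𝓝 (∫ x, Complex.exp ((∑ i : s, t i * φ x i : ℝ) * Complex.I) ∂(μ : Measure E)))) :
    Tendsto μs atTop (𝓝 μ) := by
  classical
  let ρ (s : Finset ι) (x : E) : EuclideanSpace ℝ s := WithLp.toLp 2 fun i => φ x i
  have hρ (s : Finset ι) : Continuous (ρ s) := by
    have (i : ι) : Continuous fun x => φ x i := (continuous_apply i).comp hφ.continuous
    fun_prop
  have hlim (s : Finset ι) : Tendsto (fun n => (μs n).map (hρ s).aemeasurable) atTop
      (𝓝 (μ.map (hρ s).aemeasurable)) := by
    refine ProbabilityMeasure.tendsto_of_tendsto_charFun fun t => ?_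
    have key (ν : ProbabilityMeasure E) : charFun (ν.map (hρ s).aemeasurable : Measure _) t =
        ∫ x, Complex.exp ((∑ i : s, t i * φ x i : ℝ) * Complex.I) ∂(ν : Measure E) := by
      rw [charFun_apply, ProbabilityMeasure.toMeasure_map,
        integral_map (hρ s).aemeasurable (by fun_prop)]
      simp [ρ, PiLp.inner_apply]
    simp_rw [key]
    exact h s t
  refine tendsto_of_forall_isOpen_le_liminf' fun G hG => ?_
  obtain ⟨V, hV, rfl⟩ := hφ.isOpen_iff.1 hG
  -- `W s` is the largest open set in the coordinates `s` whose preimage lies in the given open set.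
  -- These preimages increase with `s` and exhaust it, by the definition of the product topology, so
  -- the portmanteau inequality passes from finite marginals to the whole space by continuity from
  -- below.
  let W (s : Finset ι) : Set (EuclideanSpace ℝ s) := ⋃₀ {O | IsOpen O ∧ ρ s ⁻¹' O ⊆ φ ⁻¹' V}
  have hW (s : Finset ι) : IsOpen (W s) := isOpen_sUnion fun O hO => hO.1
  have hWV (s : Finset ι) : ρ s ⁻¹' W s ⊆ φ ⁻¹' V := fun x ⟨O, hO, hx⟩ => hO.2 hx
  have hmono : Monotone fun s => ρ s ⁻¹' W s := by
    rintro s s' hs x ⟨O, hO, hx⟩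
    let π (y : EuclideanSpace ℝ s') : EuclideanSpace ℝ s := WithLp.toLp 2 fun i => y ⟨i, hs i.2⟩
    have hπ : Continuous π := by fun_prop
    exact ⟨π ⁻¹' O, ⟨hO.1.preimage hπ, hO.2⟩, hx⟩
  have hUnion : ⋃ s, ρ s ⁻¹' W s = φ ⁻¹' V := by
    refine (Set.iUnion_subset hWV).antisymm fun x hx => ?_
    obtain ⟨s, u, hu, hsu⟩ := isOpen_pi_iff.1 hV (φ x) hx
    refine Set.mem_iUnion.2 ⟨s, ⋂ i : s, {y | y i ∈ u i}, ⟨?_, fun y hy => hsu fun i hi => ?_⟩, ?_⟩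
    · refine isOpen_iInter_of_finite fun i => ?_
      exact (hu i i.2).1.preimage (by fun_prop)
    · exact Set.mem_iInter.1 hy ⟨i, hi⟩
    · exact Set.mem_iInter.2 fun i => (hu i i.2).2
  rw [← hUnion, hmono.directed_le.measure_iUnion, hUnion]
  refine iSup_le fun s => ?_
  have := ProbabilityMeasure.le_liminf_measure_open_of_tendsto (hlim s) (hW s)
  simp only [ProbabilityMeasure.toMeasure_map] at this
  rw [Measure.map_apply (hρ s).measurable (hW s).measurableSet] at this
  refine this.trans (liminf_le_liminf (.of_forall fun n => ?_))
  rw [Measure.map_apply (hρ s).measurable (hW s).measurableSet]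
  exact measure_mono (hWV s)

/-- Random point measures converge in distribution if their characteristic functionals converge. -/
lemma PointMeasure.tendstoInDistribution_of_charFunctional {Ω : ℕ → Type*}
    [∀ n, MeasurableSpace (Ω n)] {μ : ∀ n, Measure (Ω n)} [∀ n, IsProbabilityMeasure (μ n)]
    {X : ∀ n, Ω n → PointMeasure} {Ω' : Type*} [MeasurableSpace Ω'] {μ' : Measure Ω'}
    [IsProbabilityMeasure μ'] {P : Ω' → PointMeasure} (hX : ∀ n, Measurable (X n))
    (hP : Measurable P)
    (h : ∀ f : ℝ → ℝ, Continuous f → HasCompactSupport f →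
      Tendsto (fun n => ∫ ω, Complex.exp ((∫ x, f x ∂(X n ω).toMeasure : ℝ) * Complex.I) ∂μ n) atTop
        (𝓝 (∫ ω, Complex.exp ((∫ x, f x ∂(P ω).toMeasure : ℝ) * Complex.I) ∂μ'))) :
    TendstoInDistribution X atTop P μ μ' where
  forall_aemeasurable n := (hX n).aemeasurable
  aemeasurable_limit := hP.aemeasurable
  tendsto := by
    refine tendsto_of_tendsto_charFun_marginals isInducing_testFun fun s t => ?_
    -- A linear combination of test functions is again continuous with compact support, so joint
    -- characteristic functions are values of the characteristic functional.
    let f (x : ℝ) : ℝ := ∑ i : s, t i * testFun i x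
    have hf : Continuous f := by fun_prop
    have hf' : HasCompactSupport f := by
      refine HasCompactSupport.intro (K := ⋃ i : s, tsupport (testFun i))
        (isCompact_iUnion fun i => (testFun i).hasCompactSupport) fun x hx => ?_
      simp only [Set.mem_iUnion, not_exists] at hx
      exact Finset.sum_eq_zero fun i _ => by simp [image_eq_zero_of_notMem_tsupport (hx i)]
    have key (m : PointMeasure) : ∫ x, f x ∂m.toMeasure = ∑ i : s, t i * m.eval (testFun i) := by
      simp only [f]
      rw [integral_finsetSum _ fun i _ => (integrable_coe _ _).const_mul _]
      simp_rw [integral_const_mul]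
      rfl
    have hm : Continuous fun m : PointMeasure =>
        Complex.exp ((∑ i : s, t i * m.eval (testFun i) : ℝ) * Complex.I) := by
      have := continuous_eval
      fun_prop
    have := h f hf hf'
    simp_rw [key] at this
    change Tendsto (fun n => ∫ m, _ ∂(μ n).map (X n)) _ (𝓝 (∫ m, _ ∂μ'.map P))
    rw [integral_map hP.aemeasurable hm.aestronglyMeasurable]
    simp_rw [integral_map (hX _).aemeasurable hm.aestronglyMeasurable]
    exact this


/-! ### Discretisation of integrals on a grid. -/

/-- The left endpoint of the cell of the grid `ℤ / N` that contains `x`. -/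
noncomputable def gridFloor (N : ℕ) (x : ℝ) : ℝ := (⌊(N : ℝ) * x⌋ : ℝ) / N

/-- The `i`-th cell of the grid `ℤ / N`, counted from `-K`. -/
def gridCell (N K i : ℕ) : Set ℝ := {x | ⌊(N : ℝ) * x⌋ = (i : ℤ) - K * N}

lemma measurableSet_gridCell (N K i : ℕ) : MeasurableSet (gridCell N K i) := by
  have : Measurable fun x : ℝ => ⌊(N : ℝ) * x⌋ := by fun_prop
  exact this (measurableSet_singleton _)

lemma tendsto_gridFloor (x : ℝ) : Tendsto (fun N => gridFloor (N + 1) x) atTop (𝓝 x) := by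
  refine tendsto_iff_dist_tendsto_zero.2 (squeeze_zero (fun _ => dist_nonneg) (fun N => ?_)
    tendsto_one_div_add_atTop_nhds_zero_nat)
  have h1 := Int.floor_le (((N + 1 : ℕ) : ℝ) * x)
  have h2 := Int.lt_floor_add_one (((N + 1 : ℕ) : ℝ) * x)
  have h3 : (0 : ℝ) < (N : ℝ) + 1 := by positivity
  rw [gridFloor, dist_comm, Real.dist_eq, abs_of_nonneg, ← sub_nonneg]
  · push_cast at *
    have : 1 / ((N : ℝ) + 1) - (x - (⌊((N : ℝ) + 1) * x⌋ : ℝ) / (N + 1)) =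
      (1 + (⌊((N : ℝ) + 1) * x⌋ : ℝ) - (N + 1) * x) / (N + 1) := by field_simp; ring
    rw [this]
    exact div_nonneg (by linarith) h3.le
  · push_cast at *
    rw [sub_nonneg, div_le_iff₀ h3]
    linarith

section

variable {E : Type*} [NormedAddCommGroup E] {f : ℝ → E} {K : ℕ}

/-- The points `-K` and `K` lie on the grid, so rounding down never brings a point from outside
`[-K, K)` into it. -/
lemma gridFloor_eq_zero (hf : ∀ x, (K : ℝ) ≤ |x| → f x = 0) {N : ℕ} (hN : 0 < N) {x : ℝ}
    (hx : x ∉ Set.Ico (-(K : ℝ)) K) : f (gridFloor N x) = 0 := by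
  have hN' : (0 : ℝ) < N := by exact_mod_cast hN
  refine hf _ ?_
  rw [Set.mem_Ico, not_and_or, not_le, not_lt] at hx
  rcases hx with hx | hx
  · refine le_trans ?_ (neg_le_abs _)
    rw [gridFloor, le_neg, div_le_iff₀ hN']
    refine (Int.floor_le _).trans ?_
    nlinarith
  · refine le_trans ?_ (le_abs_self _)
    rw [gridFloor, le_div_iff₀ hN']
    have : ((K * N : ℕ) : ℤ) ≤ ⌊(N : ℝ) * x⌋ := by
      rw [Int.le_floor]; push_cast; nlinarith
    exact_mod_cast this

lemma comp_gridFloor_eq_sum (hf : ∀ x, (K : ℝ) ≤ |x| → f x = 0) {N : ℕ} (hN : 0 < N) (x : ℝ) :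
    f (gridFloor N x) = ∑ i : Fin (2 * K * N),
      (gridCell N K i).indicator (fun _ => f (((i : ℝ) - K * N) / N)) x := by
  have hN' : (0 : ℝ) < N := by exact_mod_cast hN
  by_cases hx : x ∈ Set.Ico (-(K : ℝ)) K
  · have h1 : -((K * N : ℕ) : ℤ) ≤ ⌊(N : ℝ) * x⌋ := by
      rw [Int.le_floor]; push_cast; nlinarith [hx.1]
    have h2 : ⌊(N : ℝ) * x⌋ < ((K * N : ℕ) : ℤ) := by
      rw [Int.floor_lt]; push_cast; nlinarith [hx.2]
    obtain ⟨i, hi⟩ := Int.eq_ofNat_of_zero_le (a := ⌊(N : ℝ) * x⌋ + (K * N : ℕ)) (by omega)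
    have hi' : i < 2 * K * N := by
      have : 2 * K * N = K * N + K * N := by ring
      omega
    have hfl : ⌊(N : ℝ) * x⌋ = (i : ℤ) - K * N := by push_cast at *; linarith
    rw [Finset.sum_eq_single (⟨i, hi'⟩ : Fin (2 * K * N))]
    · rw [Set.indicator_of_mem (by exact hfl), gridFloor, hfl]
      push_cast
      rfl
    · intro j _ hj
      refine Set.indicator_of_notMem (fun h => hj ?_) _
      have h' : ⌊(N : ℝ) * x⌋ = (j : ℤ) - K * N := h
      ext
      simp only
      omega
    · simp
  · rw [gridFloor_eq_zero hf hN hx]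
    refine (Finset.sum_eq_zero fun i _ => ?_).symm
    by_cases hi : x ∈ gridCell N K i
    · rw [Set.indicator_of_mem hi]
      have h' : ⌊(N : ℝ) * x⌋ = (i : ℤ) - K * N := hi
      have := gridFloor_eq_zero hf hN hx
      rw [gridFloor, h'] at this
      push_cast at this
      exact this
    · exact Set.indicator_of_notMem hi _

lemma gridCell_subset {N : ℕ} (hN : 0 < N) (i : Fin (2 * K * N)) :
    gridCell N K i ⊆ Set.Icc (-(K : ℝ)) K := by
  intro x hx
  have hN' : (0 : ℝ) < N := by exact_mod_cast hN
  have h' : ⌊(N : ℝ) * x⌋ = (i : ℤ) - K * N := hx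
  have h1 := Int.floor_le ((N : ℝ) * x)
  have h2 := Int.lt_floor_add_one ((N : ℝ) * x)
  have h3 : ((i : ℕ) : ℝ) + 1 ≤ 2 * K * N := by exact_mod_cast i.2
  have h4 : (0 : ℝ) ≤ (i : ℕ) := by positivity
  rw [h'] at h1 h2
  push_cast at h1 h2
  constructor <;> nlinarith

variable [NormedSpace ℝ E] (m : Measure ℝ) [IsLocallyFiniteMeasure m]

lemma measure_gridCell_lt_top {N : ℕ} (hN : 0 < N) (i : Fin (2 * K * N)) :
    m (gridCell N K i) < ∞ :=
  (measure_mono (gridCell_subset hN i)).trans_lt isCompact_Icc.measure_lt_top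

lemma integral_comp_gridFloor [CompleteSpace E] (hf : ∀ x, (K : ℝ) ≤ |x| → f x = 0) {N : ℕ}
    (hN : 0 < N) : ∫ x, f (gridFloor N x) ∂m =
      ∑ i : Fin (2 * K * N), m.real (gridCell N K i) • f (((i : ℝ) - K * N) / N) := by
  simp_rw [comp_gridFloor_eq_sum hf hN]
  rw [integral_finsetSum]
  · exact Finset.sum_congr rfl fun i _ => integral_indicator_const _ (measurableSet_gridCell _ _ _)
  · intro i _
    rw [integrable_indicator_iff (measurableSet_gridCell _ _ _)]
    exact integrableOn_const (measure_gridCell_lt_top m hN i).ne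

lemma tendsto_integral_comp_gridFloor [CompleteSpace E] (hf : ∀ x, (K : ℝ) ≤ |x| → f x = 0)
    (hc : Continuous f) :
    Tendsto (fun N => ∫ x, f (gridFloor (N + 1) x) ∂m) atTop (𝓝 (∫ x, f x ∂m)) := by
  have hcs : HasCompactSupport f :=
    HasCompactSupport.intro (isCompact_Icc (a := -(K : ℝ)) (b := K)) fun x hx => hf x (by
      by_contra h
      exact hx ⟨by linarith [neg_abs_le x], by linarith [le_abs_self x]⟩)
  obtain ⟨C, hC⟩ := hcs.exists_bound_of_continuous hc
  refine tendsto_integral_of_dominated_convergence ((Set.Icc (-(K : ℝ)) K).indicator fun _ => C)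
    (fun N => ?_) ?_ (fun N => .of_forall fun x => ?_)
    (.of_forall fun x => (hc.tendsto x).comp (tendsto_gridFloor x))
  · have : Measurable (gridFloor (N + 1)) := by unfold gridFloor; fun_prop
    exact hc.stronglyMeasurable.comp_measurable this |>.aestronglyMeasurable
  · rw [integrable_indicator_iff measurableSet_Icc]
    exact integrableOn_const isCompact_Icc.measure_lt_top.ne
  · by_cases hx : x ∈ Set.Icc (-(K : ℝ)) K
    · rw [Set.indicator_of_mem hx]; exact hC _
    · rw [Set.indicator_of_notMem hx,
        gridFloor_eq_zero hf N.succ_pos fun h => hx (Set.Ico_subset_Icc_self h), norm_zero]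

end

/-! ### The characteristic functional of a Poisson process. -/

lemma integral_exp_poissonLaw {r : ℝ≥0∞} (hr : r ≠ ∞) (c : ℝ) :
    ∫ x, Complex.exp ((x.toReal * c : ℝ) * Complex.I) ∂poissonLaw r =
      Complex.exp (r.toReal * (Complex.exp (c * Complex.I) - 1)) := by
  have hm : Measurable fun k : ℕ => (k : ℝ≥0∞) := measurable_of_countable _
  have hm' : Measurable fun k : ℕ => (k : ℝ) := measurable_of_countable _
  have := charFun_map_cast_poissonMeasure r.toNNReal c
  rw [charFun_apply, integral_map hm'.aemeasurable (by fun_prop)] at this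
  rw [poissonLaw, if_neg hr, integral_map hm.aemeasurable]
  · simpa [ENNReal.coe_toNNReal_eq_toReal, mul_comm] using this
  · refine Measurable.aestronglyMeasurable ?_
    fun_prop

namespace IsPoissonPointProcess

variable {Ω : Type*} [MeasurableSpace Ω] {μ : Measure Ω} {P : Ω → PointMeasure} {h : ℝ → ℝ}

lemma measurable_count (hP : IsPoissonPointProcess P μ h) {A : Set ℝ} (hA : MeasurableSet A) :
    Measurable fun ω => (P ω).toMeasure A :=
  (Measure.measurable_coe hA).comp (PointMeasure.measurable_toMeasure.comp hP.measurable)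

lemma integral_exp_sum (hP : IsPoissonPointProcess P μ h) {m : ℕ} {A : Fin m → Set ℝ}
    (hA : ∀ i, MeasurableSet (A i)) (hd : Pairwise (Function.onFun Disjoint A))
    (hfin : ∀ i, volume.withDensity (fun x => ENNReal.ofReal (h x)) (A i) ≠ ∞) (c : Fin m → ℝ) :
    ∫ ω, Complex.exp ((∑ i, (P ω).toMeasure.real (A i) * c i : ℝ) * Complex.I) ∂μ =
      Complex.exp (∑ i, (volume.withDensity (fun x => ENNReal.ofReal (h x))).real (A i) •
        (Complex.exp (c i * Complex.I) - 1)) := by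
  have h1 := (hP.indep m A hA hd).integral_fun_prod_comp (𝕜 := ℂ)
    (f := fun i x => Complex.exp ((x.toReal * c i : ℝ) * Complex.I))
    (fun i => (hP.measurable_count (hA i)).aemeasurable)
    (fun i => Measurable.aestronglyMeasurable (by fun_prop))
  rw [Complex.exp_sum]
  simp_rw [← Complex.exp_sum] at h1
  convert h1 using 1
  · congr with ω
    push_cast
    rw [Finset.sum_mul]
    rfl
  · refine Finset.prod_congr rfl fun i _ => ?_
    have h2 := hfin i
    rw [withDensity_apply _ (hA i)] at h2
    rw [Measure.real, withDensity_apply _ (hA i)]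
    have h3 := integral_exp_poissonLaw h2 (c i)
    rw [← hP.poisson _ (hA i), integral_map (hP.measurable_count (hA i)).aemeasurable
      (Measurable.aestronglyMeasurable (by fun_prop))] at h3
    rw [h3, Complex.real_smul]

/-- For step functions the formula is exact: independence over the cells produces an exponent which
is itself the grid integral of `e^{if} - 1`. The general case then needs only a limit of grids. -/
lemma integral_exp_integral_gridFloor (hP : IsPoissonPointProcess P μ h)
    [IsLocallyFiniteMeasure (volume.withDensity fun x => ENNReal.ofReal (h x))]
    {f : ℝ → ℝ} {K : ℕ} (hf : ∀ x, (K : ℝ) ≤ |x| → f x = 0) {N : ℕ} (hN : 0 < N) :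
    ∫ ω, Complex.exp ((∫ x, f (gridFloor N x) ∂(P ω).toMeasure : ℝ) * Complex.I) ∂μ =
      Complex.exp (∫ x, (Complex.exp (f (gridFloor N x) * Complex.I) - 1)
        ∂volume.withDensity fun x => ENNReal.ofReal (h x)) := by
  simp_rw [integral_comp_gridFloor _ hf hN, smul_eq_mul]
  rw [hP.integral_exp_sum (fun i => measurableSet_gridCell _ _ _) _
    (fun i => (measure_gridCell_lt_top _ hN i).ne)]
  · rw [integral_comp_gridFloor (f := fun x => Complex.exp (f x * Complex.I) - 1) _ _ hN]
    intro x hx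
    simp [hf x hx]
  · intro i j hij
    refine Set.disjoint_left.2 fun x hi hj => hij ?_
    have hi' : ⌊(N : ℝ) * x⌋ = (i : ℤ) - K * N := hi
    have hj' : ⌊(N : ℝ) * x⌋ = (j : ℤ) - K * N := hj
    ext
    omega

/-- The characteristic functional of a Poisson point process. -/
theorem integral_exp_integral (hP : IsPoissonPointProcess P μ h) [IsProbabilityMeasure μ]
    [IsLocallyFiniteMeasure (volume.withDensity fun x => ENNReal.ofReal (h x))]
    {f : ℝ → ℝ} (hf : Continuous f) (hcs : HasCompactSupport f) :
    ∫ ω, Complex.exp ((∫ x, f x ∂(P ω).toMeasure : ℝ) * Complex.I) ∂μ =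
      Complex.exp (∫ x, (Complex.exp (f x * Complex.I) - 1)
        ∂volume.withDensity fun x => ENNReal.ofReal (h x)) := by
  obtain ⟨R, hR⟩ := hcs.isCompact.isBounded.subset_closedBall 0
  obtain ⟨K, hK⟩ := exists_nat_gt R
  have hf0 : ∀ x, (K : ℝ) ≤ |x| → f x = 0 := fun x hx => by
    by_contra h
    have := hR (subset_tsupport _ (Function.mem_support.2 h))
    simp at this
    linarith
  have hlim : Tendsto (fun N : ℕ => ∫ ω, Complex.exp
      ((∫ x, f (gridFloor (N + 1) x) ∂(P ω).toMeasure : ℝ) * Complex.I) ∂μ) atTop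
      (𝓝 (∫ ω, Complex.exp ((∫ x, f x ∂(P ω).toMeasure : ℝ) * Complex.I) ∂μ)) := by
    refine tendsto_integral_of_dominated_convergence (fun _ => 1) (fun N => ?_)
      (integrable_const _) (fun N => .of_forall fun ω => (Complex.norm_exp_ofReal_mul_I _).le)
      (.of_forall fun ω => ?_)
    · simp_rw [integral_comp_gridFloor _ hf0 N.succ_pos, smul_eq_mul, Measure.real]
      have := fun i => hP.measurable_count (measurableSet_gridCell (N + 1) K i)
      exact Measurable.aestronglyMeasurable (by fun_prop)
    · have h1 := tendsto_integral_comp_gridFloor (P ω).toMeasure hf0 hf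
      have h2 : Continuous fun y : ℝ => Complex.exp (y * Complex.I) := by fun_prop
      exact (h2.tendsto _).comp h1
  refine tendsto_nhds_unique hlim ?_
  simp_rw [hP.integral_exp_integral_gridFloor hf0 (Nat.succ_pos _)]
  refine (Complex.continuous_exp.tendsto _).comp ?_
  exact tendsto_integral_comp_gridFloor (K := K) (f := fun x => Complex.exp (f x * Complex.I) - 1) _
    (fun x hx => by simp [hf0 x hx]) (by fun_prop)

end IsPoissonPointProcess


/-! ### Finite Poisson samples and their Laplace functional. -/

/-- The function `x ↦ exp (-x)` from `[0, ∞]` to `[0, ∞]`, with `exp (-∞) = 0`. -/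
noncomputable def negExp (x : ℝ≥0∞) : ℝ≥0∞ := (EReal.exp (x : EReal))⁻¹

namespace negExp

@[simp] lemma zero : negExp 0 = 1 := by simp [negExp]

@[simp] lemma top : negExp ∞ = 0 := by simp [negExp]

lemma le_one (x : ℝ≥0∞) : negExp x ≤ 1 := by
  rw [negExp, ENNReal.inv_le_one, EReal.one_le_exp_iff]
  exact EReal.coe_ennreal_nonneg x

lemma ne_top (x : ℝ≥0∞) : negExp x ≠ ∞ := ((le_one x).trans_lt ENNReal.one_lt_top).ne

lemma add (x y : ℝ≥0∞) : negExp (x + y) = negExp x * negExp y := by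
  rw [negExp, negExp, negExp, EReal.coe_ennreal_add, EReal.exp_add, ENNReal.mul_inv]
  · left
    rw [Ne, EReal.exp_eq_zero_iff]
    exact EReal.coe_ennreal_ne_bot x
  · right
    rw [Ne, EReal.exp_eq_zero_iff]
    exact EReal.coe_ennreal_ne_bot y

lemma sum {ι : Type*} (s : Finset ι) (f : ι → ℝ≥0∞) :
    negExp (∑ i ∈ s, f i) = ∏ i ∈ s, negExp (f i) := by
  classical
  induction s using Finset.induction_on with
  | empty => simp
  | insert i s hi ih => rw [Finset.sum_insert hi, Finset.prod_insert hi, add, ih]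

lemma nat_mul (k : ℕ) (x : ℝ≥0∞) : negExp (k * x) = negExp x ^ k := by
  have := sum (Finset.range k) fun _ => x
  simpa using this

lemma continuous : Continuous negExp :=
  (ENNReal.continuous_exp.comp continuous_coe_ennreal_ereal).inv

lemma measurable : Measurable negExp := continuous.measurable

lemma injective : Function.Injective negExp := by
  intro x y h
  have := EReal.exp_strictMono.injective (inv_injective h)
  exact EReal.coe_ennreal_injective this

lemma of_ne_top {x : ℝ≥0∞} (hx : x ≠ ∞) : negExp x = ENNReal.ofReal (Real.exp (-x.toReal)) := by
  lift x to ℝ≥0 using hx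
  rw [negExp, EReal.coe_nnreal_eq_coe_real, EReal.exp_coe, Real.exp_neg,
    ENNReal.ofReal_inv_of_pos (Real.exp_pos _)]
  simp

end negExp

lemma tsum_pow_mul_inv_factorial {c : ℝ≥0∞} (hc : c ≠ ∞) :
    ∑' k : ℕ, ((k.factorial : ℝ≥0∞)⁻¹ * c ^ k) = ENNReal.ofReal (Real.exp c.toReal) := by
  lift c to ℝ≥0 using hc
  rw [Real.exp_eq_exp_ℝ, ENNReal.coe_toReal,
    ← (NormedSpace.expSeries_div_hasSum_exp (c : ℝ)).tsum_eq,
    ENNReal.ofReal_tsum_of_nonneg (fun k => by positivity)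
    (NormedSpace.expSeries_div_hasSum_exp (c : ℝ)).summable]
  refine tsum_congr fun k => ?_
  rw [ENNReal.ofReal_div_of_pos (by positivity), ENNReal.ofReal_pow (by simp), mul_comm,
    ← div_eq_mul_inv]
  simp

/-- This is `e^{-(a+b)} e^a = e^{-b}`, with `b` possibly infinite. It is applied after splitting the
total mass, or the mean, into a part `a` absorbed by the exponential series and a remainder `b`. -/
lemma negExp_mul_tsum {a : ℝ≥0∞} (ha : a ≠ ∞) (b : ℝ≥0∞) :
    negExp (a + b) * ∑' k : ℕ, ((k.factorial : ℝ≥0∞)⁻¹ * a ^ k) = negExp b := by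
  rw [tsum_pow_mul_inv_factorial ha, negExp.add, mul_right_comm, negExp.of_ne_top ha,
    ← ENNReal.ofReal_mul (Real.exp_nonneg _), ← Real.exp_add]
  simp

lemma lintegral_fin_prod_eq_prod {n : ℕ} {E : Type*} {mE : MeasurableSpace E} {μ : Measure E}
    [SigmaFinite μ] {f : E → ℝ≥0∞} (hf : Measurable f) :
    ∫⁻ x : Fin n → E, ∏ i, f (x i) ∂(Measure.pi fun _ => μ) = (∫⁻ x, f x ∂μ) ^ n := by
  induction n with
  | zero => simp
  | succ n ih =>
    rw [← ((measurePreserving_piFinSuccAbove (fun _ : Fin (n + 1) => μ) 0).symm).lintegral_comp_emb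
      (MeasurableEquiv.measurableEmbedding _)]
    simp_rw [MeasurableEquiv.piFinSuccAbove_symm_apply, Fin.insertNthEquiv,
      Fin.prod_univ_succ, Fin.insertNth_zero, Equiv.coe_fn_mk, Fin.cons_succ, Fin.cons_zero]
    have hg : Measurable fun x : Fin n → E => ∏ i, f (x i) :=
      Finset.measurable_prod _ fun i _ => hf.comp (measurable_pi_apply i)
    exact (lintegral_prod_mul hf.aemeasurable hg.aemeasurable).trans (by rw [ih, pow_succ'])

section FinitePoisson

/-- A Poisson number of independent points: given the number `k` of points, they are independent
with law proportional to `ν`. -/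
noncomputable def poissonSample (ν : Measure ℝ) : Measure (Σ k : ℕ, Fin k → ℝ) :=
  negExp (ν Set.univ) • Measure.sum fun k : ℕ =>
    (k.factorial : ℝ≥0∞)⁻¹ • (Measure.pi fun _ : Fin k => ν).map (Sigma.mk k)

lemma measurable_sigmaMk {ι : Type*} {E : ι → Type*} [∀ i, MeasurableSpace (E i)] (i : ι) :
    Measurable (Sigma.mk i : E i → Σ i, E i) :=
  measurable_iff_le_map.2 (iInf_le _ i)

/-- Given `k` points, the product integrates to `(∫ u)^k`, and the sum over `k` is an exponential
series. Taking `u = 1` gives total mass one; taking `u = negExp ∘ φ` gives the Laplace functional.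
-/
lemma lintegral_poissonSample_prod (ν : Measure ℝ) [IsFiniteMeasure ν] {u : ℝ → ℝ≥0∞}
    (hu : Measurable u) (hu1 : ∀ x, u x ≤ 1) {G : (Σ k : ℕ, Fin k → ℝ) → ℝ≥0∞} (hG : Measurable G)
    (hGu : ∀ s, G s = ∏ i, u (s.2 i)) :
    ∫⁻ s, G s ∂poissonSample ν = negExp (∫⁻ x, (1 - u x) ∂ν) := by
  have hfin {v : ℝ → ℝ≥0∞} (hv : ∀ x, v x ≤ 1) : ∫⁻ x, v x ∂ν ≠ ∞ :=
    ((lintegral_mono hv).trans_lt (by simp)).ne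
  have huniv : ν Set.univ = ∫⁻ x, u x ∂ν + ∫⁻ x, (1 - u x) ∂ν := by
    rw [← lintegral_add_left hu]
    simp [add_tsub_cancel_of_le (hu1 _)]
  rw [poissonSample, lintegral_smul_measure, lintegral_sum_measure]
  simp_rw [lintegral_smul_measure, lintegral_map hG (measurable_sigmaMk _), hGu,
    lintegral_fin_prod_eq_prod hu, smul_eq_mul]
  rw [huniv, negExp_mul_tsum (hfin hu1)]

instance (ν : Measure ℝ) [IsFiniteMeasure ν] : IsProbabilityMeasure (poissonSample ν) :=
  ⟨by
    have := lintegral_poissonSample_prod ν (u := fun _ => 1) (G := fun _ => 1) measurable_const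
      (fun _ => le_rfl) measurable_const (by simp)
    simpa using this⟩

/-- The counting measure of a finite family of points. -/
noncomputable def countingMeasure (s : Σ k : ℕ, Fin k → ℝ) : Measure ℝ :=
  ∑ i, Measure.dirac (s.2 i)

lemma lintegral_countingMeasure (s : Σ k : ℕ, Fin k → ℝ) (φ : ℝ → ℝ≥0∞) :
    ∫⁻ x, φ x ∂countingMeasure s = ∑ i, φ (s.2 i) := by
  simp [countingMeasure, lintegral_finsetSum_measure]

lemma measurable_countingMeasure : Measurable countingMeasure := by
  refine Measure.measurable_of_measurable_coe _ fun A hA => ?_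
  have (k : ℕ) : Measurable fun x : Fin k → ℝ => countingMeasure ⟨k, x⟩ A := by
    simp only [countingMeasure, Measure.finsetSum_apply, Measure.dirac_apply' _ hA]
    have h1 : Measurable (A.indicator (1 : ℝ → ℝ≥0∞)) := measurable_one.indicator hA
    change Measurable fun x : Fin k → ℝ => ∑ i : Fin k, A.indicator (1 : ℝ → ℝ≥0∞) (x i)
    fun_prop
  intro B hB
  exact MeasurableSpace.measurableSet_iInf.2 fun k => this k hB

instance (s : Σ k : ℕ, Fin k → ℝ) : IsFiniteMeasure (countingMeasure s) := by
  unfold countingMeasure; infer_instance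

lemma exists_countingMeasure_eq (s : Σ k : ℕ, Fin k → ℝ) {A : Set ℝ} (hA : MeasurableSet A) :
    ∃ k : ℕ, countingMeasure s A = k := by
  classical
  refine ⟨∑ i, if s.2 i ∈ A then 1 else 0, ?_⟩
  simp [countingMeasure, hA, Set.indicator_apply]

lemma lintegral_negExp_countingMeasure (ν : Measure ℝ) [IsFiniteMeasure ν] {φ : ℝ → ℝ≥0∞}
    (hφ : Measurable φ) :
    ∫⁻ s, negExp (∫⁻ x, φ x ∂countingMeasure s) ∂poissonSample ν =
      negExp (∫⁻ x, (1 - negExp (φ x)) ∂ν) := by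
  refine lintegral_poissonSample_prod ν (negExp.measurable.comp hφ) (fun x => negExp.le_one _)
    (negExp.measurable.comp ((Measure.measurable_lintegral hφ).comp measurable_countingMeasure))
    fun s => ?_
  rw [lintegral_countingMeasure, negExp.sum]
  rfl

end FinitePoisson


/-! ### Superposition of samples over bounded pieces. -/

section Superposition

/-- A partition of the line into countably many bounded pieces. -/
def piece : ℕ → Set ℝ := disjointed fun j : ℕ => Set.Ioo (-(j : ℝ)) j

lemma measurableSet_piece (j : ℕ) : MeasurableSet (piece j) :=
  MeasurableSet.disjointed (fun _ => measurableSet_Ioo) j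

lemma iUnion_piece : ⋃ j, piece j = Set.univ := by
  rw [piece, iUnion_disjointed, Set.eq_univ_iff_forall]
  intro x
  obtain ⟨N, hN⟩ := exists_nat_gt |x|
  exact Set.mem_iUnion.2 ⟨N, abs_lt.1 hN⟩

lemma pairwise_disjoint_piece : Pairwise (Function.onFun Disjoint piece) := disjoint_disjointed _

lemma piece_subset (j : ℕ) : piece j ⊆ Set.Icc (-(j : ℝ)) j :=
  (disjointed_subset _ j).trans Set.Ioo_subset_Icc_self

/-- Only finitely many pieces meet a bounded window; this makes the superposition locally finite. -/
lemma piece_inter_Ioo {j K : ℕ} (h : K < j) : piece j ∩ Set.Ioo (-(K : ℝ)) K = ∅ := by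
  refine Set.eq_empty_of_forall_notMem fun x ⟨hx, hK⟩ => ?_
  have hle : Set.Ioo (-(K : ℝ)) K ⊆ (Finset.Iio j).sup fun j : ℕ => Set.Ioo (-(j : ℝ)) j :=
    Finset.le_sup (f := fun j : ℕ => Set.Ioo (-(j : ℝ)) j) (Finset.mem_Iio.2 h)
  exact hx.2 (hle hK)

instance (Λ : Measure ℝ) [IsLocallyFiniteMeasure Λ] (j : ℕ) :
    IsFiniteMeasure (Λ.restrict (piece j)) :=
  ⟨by
    rw [Measure.restrict_apply_univ]
    exact (measure_mono (piece_subset j)).trans_lt isCompact_Icc.measure_lt_top⟩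

/-- The superposition of finite point configurations, the `j`-th of them restricted to the `j`-th
piece of the partition. -/
noncomputable def superposition (ω : ℕ → Σ k : ℕ, Fin k → ℝ) : Measure ℝ :=
  Measure.sum fun j => (countingMeasure (ω j)).restrict (piece j)

lemma isLocallyFiniteMeasure_superposition (ω : ℕ → Σ k : ℕ, Fin k → ℝ) :
    IsLocallyFiniteMeasure (superposition ω) := by
  refine ⟨fun x => ?_⟩
  obtain ⟨N, hN⟩ := exists_nat_gt |x|
  refine ⟨Set.Ioo (-(N : ℝ)) N, isOpen_Ioo.mem_nhds (abs_lt.1 hN), ?_⟩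
  rw [superposition, Measure.sum_apply _ measurableSet_Ioo,
    tsum_eq_sum (s := Finset.range (N + 1))]
  · exact ENNReal.sum_lt_top.2 fun j _ => measure_lt_top _ _
  · intro j hj
    rw [Measure.restrict_apply measurableSet_Ioo, Set.inter_comm, piece_inter_Ioo, measure_empty]
    simpa using hj

lemma integerValued_superposition (ω : ℕ → Σ k : ℕ, Fin k → ℝ) {A : Set ℝ} (hA : MeasurableSet A) :
    ∃ k : ℕ∞, superposition ω A = (k : ℝ≥0∞) := by
  choose k hk using fun j => exists_countingMeasure_eq (ω j) (hA.inter (measurableSet_piece j))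
  refine ⟨⨆ n, ((∑ j ∈ Finset.range n, k j : ℕ) : ℕ∞), ?_⟩
  rw [superposition, Measure.sum_apply _ hA, ENat.toENNReal_iSup, ENNReal.tsum_eq_iSup_nat]
  simp_rw [Measure.restrict_apply hA, hk]
  exact iSup_congr fun n => by rw [ENat.toENNReal_coe, Nat.cast_sum]

lemma measurable_superposition : Measurable superposition := by
  refine Measure.measurable_of_measurable_coe _ fun A hA => ?_
  simp_rw [superposition, Measure.sum_apply _ hA, Measure.restrict_apply hA]
  exact .tsum fun j => (Measure.measurable_coe (hA.inter (measurableSet_piece j))).comp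
    (measurable_countingMeasure.comp (measurable_pi_apply j))

/-- The law of the independent family of samples whose superposition is a Poisson process. -/
noncomputable def samplesLaw (Λ : Measure ℝ) : Measure (ℕ → Σ k : ℕ, Fin k → ℝ) :=
  Measure.infinitePi fun j => poissonSample (Λ.restrict (piece j))

/-- The Laplace functional of the superposition. -/
lemma lintegral_negExp_superposition (Λ : Measure ℝ) [IsLocallyFiniteMeasure Λ] {φ : ℝ → ℝ≥0∞}
    (hφ : Measurable φ) :
    ∫⁻ ω, negExp (∫⁻ x, φ x ∂superposition ω) ∂samplesLaw Λ =
      negExp (∫⁻ x, (1 - negExp (φ x)) ∂Λ) := by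
  let Y (j : ℕ) (s : Σ k : ℕ, Fin k → ℝ) : ℝ≥0∞ :=
    negExp (∫⁻ x, (piece j).indicator φ x ∂countingMeasure s)
  have hY (j : ℕ) : Measurable (Y j) :=
    negExp.measurable.comp ((Measure.measurable_lintegral
      (hφ.indicator (measurableSet_piece j))).comp measurable_countingMeasure)
  have hYint (j : ℕ) : ∫⁻ ω, Y j (ω j) ∂samplesLaw Λ =
      negExp (∫⁻ x in piece j, (1 - negExp (φ x)) ∂Λ) := by
    have h1 := lintegral_negExp_countingMeasure (Λ.restrict (piece j))
      (hφ.indicator (measurableSet_piece j))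
    rw [samplesLaw]
    rw [← Measure.infinitePi_map_eval (fun j => poissonSample (Λ.restrict (piece j))) j,
      lintegral_map (hY j) (measurable_pi_apply j)] at h1
    rw [h1]
    congr 1
    refine setLIntegral_congr_fun (measurableSet_piece j) fun x hx => ?_
    simp only [Set.indicator_of_mem hx]
  have hprod (n : ℕ) : ∫⁻ ω, ∏ j ∈ Finset.range n, Y j (ω j) ∂samplesLaw Λ =
      negExp (∑ j ∈ Finset.range n, ∫⁻ x in piece j, (1 - negExp (φ x)) ∂Λ) := by
    have hind : iIndepFun (fun j (ω : ℕ → Σ k : ℕ, Fin k → ℝ) => Y j (ω j)) (samplesLaw Λ) := by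
      unfold samplesLaw
      exact iIndepFun_infinitePi hY
    rw [lintegral_prod_eq_prod_lintegral_of_indepFun (Finset.range n) _ hind
      fun j => (hY j).comp (measurable_pi_apply j), negExp.sum]
    exact Finset.prod_congr rfl fun j _ => hYint j
  -- From finitely many pieces to all of them: the products are bounded by `1`, and `negExp` is
  -- continuous also at `∞`, so divergent sums do no harm.
  have hlim1 : Tendsto (fun n => ∫⁻ ω, ∏ j ∈ Finset.range n, Y j (ω j) ∂samplesLaw Λ) atTop
      (𝓝 (∫⁻ ω, negExp (∫⁻ x, φ x ∂superposition ω) ∂samplesLaw Λ)) := by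
    have : IsProbabilityMeasure (samplesLaw Λ) := by unfold samplesLaw; infer_instance
    refine tendsto_lintegral_of_dominated_convergence (fun _ => 1) (fun n => ?_) (fun n => ?_)
      (by simp) (.of_forall fun ω => ?_)
    · exact Finset.measurable_prod _ fun j _ => (hY j).comp (measurable_pi_apply j)
    · exact .of_forall fun ω => Finset.prod_le_one' fun j _ => negExp.le_one _
    · simp_rw [Y, ← negExp.sum]
      refine (negExp.continuous.tendsto _).comp ?_
      rw [superposition, lintegral_sum_measure]
      simp_rw [lintegral_indicator (measurableSet_piece _)]
      exact ENNReal.summable.hasSum.tendsto_sum_nat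
  refine tendsto_nhds_unique hlim1 ?_
  simp_rw [hprod]
  refine (negExp.continuous.tendsto _).comp ?_
  have : ∫⁻ x, (1 - negExp (φ x)) ∂Λ = ∑' j, ∫⁻ x in piece j, (1 - negExp (φ x)) ∂Λ := by
    rw [← lintegral_iUnion measurableSet_piece pairwise_disjoint_piece, iUnion_piece,
      Measure.restrict_univ]
  rw [this]
  exact ENNReal.summable.hasSum.tendsto_sum_nat

end Superposition

/-! ### Laplace transforms determine laws; existence of Poisson processes. -/

/-- Probability measures on `[0, ∞]^ι` are determined by their Laplace transforms. -/
lemma ext_of_lintegral_negExp {ι : Type*} [Fintype ι] {P Q : Measure (ι → ℝ≥0∞)}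
    [IsProbabilityMeasure P] [IsProbabilityMeasure Q]
    (h : ∀ k : ι → ℕ, ∫⁻ x, ∏ i, negExp (x i) ^ k i ∂P = ∫⁻ x, ∏ i, negExp (x i) ^ k i ∂Q) :
    P = Q := by
  classical
  let y (k : ι → ℕ) : BoundedContinuousFunction (ι → ℝ≥0∞) ℝ :=
    BoundedContinuousFunction.ofNormedAddCommGroup (fun x => ∏ i, (negExp (x i)).toReal ^ k i)
      (continuous_finsetProd _ fun i _ => (ENNReal.continuousOn_toReal.comp_continuous
        (negExp.continuous.comp (continuous_apply i)) fun x => negExp.ne_top _).pow _) 1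
      (fun x => by
        rw [Real.norm_of_nonneg (Finset.prod_nonneg fun i _ => by positivity)]
        exact Finset.prod_le_one (fun i _ => by positivity) fun i _ =>
          pow_le_one₀ ENNReal.toReal_nonneg (ENNReal.toReal_le_of_le_ofReal zero_le_one
            (by simpa using negExp.le_one _)))
  have hy (k : ι → ℕ) (x : ι → ℝ≥0∞) : y k x = ∏ i, (negExp (x i)).toReal ^ k i := rfl
  -- The monomials are closed under multiplication, so the algebra they generate is their linear
  -- span and equality of integrals extends by linearity.
  let M : Submonoid (BoundedContinuousFunction (ι → ℝ≥0∞) ℝ) :=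
    { carrier := Set.range y
      one_mem' := ⟨0, by ext x; simp [hy]⟩
      mul_mem' := by
        rintro _ _ ⟨k, rfl⟩ ⟨l, rfl⟩
        exact ⟨k + l, by ext x; simp [hy, pow_add, Finset.prod_mul_distrib]⟩ }
  let A : StarSubalgebra ℝ (BoundedContinuousFunction (ι → ℝ≥0∞) ℝ) :=
    { Algebra.adjoin ℝ (Set.range y) with
      star_mem' := fun {g} hg => by
        have : star g = g := by ext x; simp
        rwa [this] }
  refine ext_of_forall_mem_subalgebra_integral_eq_of_polish (𝕜 := ℝ) (A := A) ?_ ?_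
  -- Points are separated by single coordinates, since `negExp` is injective on all of `[0, ∞]`.
  · intro x x' hx
    obtain ⟨i, hi⟩ := Function.ne_iff.1 hx
    refine ⟨_, ⟨(y (Pi.single i 1)).toContinuousMap, ⟨y (Pi.single i 1),
      Algebra.subset_adjoin ⟨_, rfl⟩, rfl⟩, rfl⟩, fun heq => hi (negExp.injective ?_)⟩
    have h1 : y (Pi.single i 1) x = y (Pi.single i 1) x' := heq
    have h2 (x : ι → ℝ≥0∞) : y (Pi.single i 1) x = (negExp (x i)).toReal := by
      rw [hy, Finset.prod_eq_single i] <;> simp +contextual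
    rw [h2, h2] at h1
    exact (ENNReal.toReal_eq_toReal_iff' (negExp.ne_top _) (negExp.ne_top _)).1 h1
  · intro g hg
    have hg' : g ∈ Algebra.adjoin ℝ (M : Set (BoundedContinuousFunction (ι → ℝ≥0∞) ℝ)) := hg
    rw [← Subalgebra.mem_toSubmodule, Algebra.adjoin_eq_span, Submonoid.closure_eq] at hg'
    clear hg
    induction hg' using Submodule.span_induction with
    | mem g hg =>
      obtain ⟨k, rfl⟩ := hg
      have h3 (ν : Measure (ι → ℝ≥0∞)) [IsProbabilityMeasure ν] :
          ∫ x, y k x ∂ν = (∫⁻ x, ∏ i, negExp (x i) ^ k i ∂ν).toReal := by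
        rw [← integral_toReal]
        · simp [hy, ENNReal.toReal_prod]
        · have := negExp.measurable
          exact Measurable.aemeasurable (by fun_prop)
        · exact .of_forall fun x => ENNReal.prod_lt_top fun i _ =>
            (ENNReal.pow_ne_top (negExp.ne_top _)).lt_top
      rw [h3, h3, h k]
    | zero => simp
    | add f g _ _ hf hg =>
      simp only [BoundedContinuousFunction.coe_add, Pi.add_apply]
      rw [integral_add (f.integrable _) (g.integrable _),
        integral_add (f.integrable _) (g.integrable _), hf, hg]
    | smul c g _ hg =>
      simp only [BoundedContinuousFunction.coe_smul]
      rw [integral_smul, integral_smul, hg]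


lemma lintegral_poissonMeasure (r : ℝ≥0) (f : ℕ → ℝ≥0∞) :
    ∫⁻ n, f n ∂poissonMeasure r = ∑' n : ℕ, negExp r * ((n.factorial : ℝ≥0∞)⁻¹ * r ^ n) * f n := by
  rw [lintegral_countable']
  refine tsum_congr fun n => ?_
  rw [poissonMeasure_singleton, negExp.of_ne_top ENNReal.coe_ne_top, mul_comm,
    ENNReal.ofReal_div_of_pos (by positivity), ENNReal.ofReal_mul (Real.exp_nonneg _),
    ENNReal.ofReal_pow (by simp), div_eq_mul_inv]
  simp only [ENNReal.ofReal_coe_nnreal, ENNReal.ofReal_natCast,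
    ENNReal.coe_toReal]
  ring

instance (r : ℝ≥0∞) : IsProbabilityMeasure (poissonLaw r) := by
  unfold poissonLaw
  split_ifs
  · infer_instance
  · exact Measure.isProbabilityMeasure_map (measurable_of_countable _).aemeasurable

lemma lintegral_negExp_pow_poissonLaw (r : ℝ≥0∞) (k : ℕ) :
    ∫⁻ x, negExp x ^ k ∂poissonLaw r = negExp ((1 - negExp k) * r) := by
  by_cases hr : r = ∞
  · subst hr
    rw [poissonLaw, if_pos rfl, lintegral_dirac' _ (negExp.measurable.pow_const k), negExp.top]
    -- For `k = 0` both sides are `1`, by the convention `0 * ∞ = 0`; for `k > 0` the factor `1 -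
    -- e^{-k}` is non-zero and both sides vanish.
    rcases Nat.eq_zero_or_pos k with rfl | hk
    · simp
    · have : 1 - negExp k ≠ 0 := by
        rw [Ne, tsub_eq_zero_iff_le, not_le]
        refine (negExp.le_one _).lt_of_ne fun h => ?_
        have := negExp.injective (h.trans negExp.zero.symm)
        simp at this
        omega
      rw [ENNReal.mul_top this, zero_pow hk.ne', negExp.top]
  · rw [poissonLaw, if_neg hr, lintegral_map (negExp.measurable.pow_const k)
      (measurable_of_countable _), lintegral_poissonMeasure, ENNReal.coe_toNNReal hr]
    have h1 : r = r * negExp k + (1 - negExp k) * r := by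
      rw [mul_comm _ r, ← mul_add, add_tsub_cancel_of_le (negExp.le_one _), mul_one]
    have h2 (n : ℕ) : negExp r * ((n.factorial : ℝ≥0∞)⁻¹ * r ^ n) * negExp n ^ k =
        negExp r * ((n.factorial : ℝ≥0∞)⁻¹ * (r * negExp k) ^ n) := by
      rw [← negExp.nat_mul, mul_comm (k : ℝ≥0∞), negExp.nat_mul, mul_pow]
      ring
    simp_rw [h2]
    rw [ENNReal.tsum_mul_left]
    nth_rewrite 1 [h1]
    exact negExp_mul_tsum (ENNReal.mul_ne_top hr (negExp.ne_top _)) _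

/-- A random point measure whose Laplace functional is that of a Poisson point process is a Poisson
point process. -/
lemma isPoissonPointProcess_of_laplace {Ω : Type*} [MeasurableSpace Ω] {μ : Measure Ω}
    [IsProbabilityMeasure μ] {P : Ω → PointMeasure} (hP : Measurable P) {h : ℝ → ℝ}
    (hL : ∀ φ : ℝ → ℝ≥0∞, Measurable φ → ∫⁻ ω, negExp (∫⁻ x, φ x ∂(P ω).toMeasure) ∂μ =
      negExp (∫⁻ x, (1 - negExp (φ x)) ∂volume.withDensity fun x => ENNReal.ofReal (h x))) :
    IsPoissonPointProcess P μ h := by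
  set Λ := volume.withDensity fun x => ENNReal.ofReal (h x)
  have hcount {A : Set ℝ} (hA : MeasurableSet A) : Measurable fun ω => (P ω).toMeasure A :=
    (Measure.measurable_coe hA).comp (PointMeasure.measurable_toMeasure.comp hP)
  have joint {m : ℕ} {A : Fin m → Set ℝ} (hA : ∀ i, MeasurableSet (A i))
      (hd : Pairwise (Function.onFun Disjoint A)) :
      μ.map (fun ω i => (P ω).toMeasure (A i)) = Measure.pi fun i => poissonLaw (Λ (A i)) := by
    have hmeas : Measurable fun ω i => (P ω).toMeasure (A i) :=
      measurable_pi_lambda _ fun i => hcount (hA i)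
    have : IsProbabilityMeasure (μ.map (fun ω i => (P ω).toMeasure (A i))) :=
      Measure.isProbabilityMeasure_map hmeas.aemeasurable
    refine ext_of_lintegral_negExp fun k => ?_
    have hm : Measurable fun x : Fin m → ℝ≥0∞ => ∏ i, negExp (x i) ^ k i := by
      have := negExp.measurable
      fun_prop
    rw [lintegral_map hm hmeas]
    have hind : iIndepFun (fun i (x : Fin m → ℝ≥0∞) => negExp (x i) ^ k i)
        (Measure.pi fun i => poissonLaw (Λ (A i))) :=
      iIndepFun_pi fun i => (negExp.measurable.pow_const (k i)).aemeasurable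
    rw [lintegral_prod_eq_prod_lintegral_of_indepFun _ _ hind
      fun i => (negExp.measurable.pow_const (k i)).comp (measurable_pi_apply i)]
    have hmarg (i : Fin m) : ∫⁻ x : Fin m → ℝ≥0∞, negExp (x i) ^ k i
        ∂(Measure.pi fun i => poissonLaw (Λ (A i))) = negExp ((1 - negExp (k i)) * Λ (A i)) := by
      rw [← lintegral_negExp_pow_poissonLaw]
      exact (measurePreserving_eval (fun i => poissonLaw (Λ (A i))) i).lintegral_comp
        (negExp.measurable.pow_const (k i))
    simp_rw [hmarg]
    -- With this step function the Laplace functional becomes the joint Laplace transform of the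
    -- counts; disjointness of the sets turns `1 - negExp ∘ φ` into a sum over them.
    let φ (x : ℝ) : ℝ≥0∞ := ∑ i, (A i).indicator (fun _ => (k i : ℝ≥0∞)) x
    have hφ : Measurable φ :=
      Finset.measurable_fun_sum _ fun i _ => measurable_const.indicator (hA i)
    have hφint (ν : Measure ℝ) : ∫⁻ x, φ x ∂ν = ∑ i, k i * ν (A i) := by
      simp only [φ]
      rw [lintegral_finsetSum _ fun i _ => measurable_const.indicator (hA i)]
      simp_rw [lintegral_indicator_const (hA _)]
    have hφneg (x : ℝ) : 1 - negExp (φ x) =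
        ∑ i, (A i).indicator (fun _ => 1 - negExp (k i)) x := by
      by_cases hx : ∃ i, x ∈ A i
      · obtain ⟨i, hi⟩ := hx
        have hj (j : Fin m) (hj : j ≠ i) : x ∉ A j := fun h =>
          Set.disjoint_left.1 (hd hj) h hi
        simp only [φ]
        rw [Finset.sum_eq_single i, Finset.sum_eq_single i, Set.indicator_of_mem hi,
          Set.indicator_of_mem hi]
        · exact fun j _ hji => Set.indicator_of_notMem (hj j hji) _
        · simp
        · exact fun j _ hji => Set.indicator_of_notMem (hj j hji) _
        · simp
      · push Not at hx
        simp [φ, hx]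
    have hL' := hL φ hφ
    simp_rw [hφneg, hφint] at hL'
    rw [lintegral_finsetSum _ fun i _ => measurable_const.indicator (hA i)] at hL'
    simp_rw [lintegral_indicator_const (hA _), negExp.sum, negExp.nat_mul] at hL'
    exact hL'
  have marginal {A : Set ℝ} (hA : MeasurableSet A) :
      μ.map (fun ω => (P ω).toMeasure A) = poissonLaw (Λ A) := by
    have h1 := joint (m := 1) (A := fun _ => A) (fun _ => hA)
      (fun i j hij => (hij (Subsingleton.elim i j)).elim)
    have h2 := congrArg (Measure.map fun x : Fin 1 → ℝ≥0∞ => x 0) h1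
    rw [Measure.map_map (measurable_pi_apply 0) (measurable_pi_lambda _ fun _ => hcount hA)] at h2
    exact h2.trans (measurePreserving_eval (fun _ : Fin 1 => poissonLaw (Λ A)) 0).map_eq
  refine ⟨hP, fun m A hA hd => ?_, fun A hA => ?_⟩
  · rw [iIndepFun_iff_map_fun_eq_pi_map fun i => (hcount (hA i)).aemeasurable, joint hA hd]
    simp_rw [marginal (hA _)]
  · rw [marginal hA, withDensity_apply _ hA]

/-- Poisson point processes with locally finite intensity exist. -/
theorem exists_isPoissonPointProcess (h : ℝ → ℝ)
    [IsLocallyFiniteMeasure (volume.withDensity fun x => ENNReal.ofReal (h x))] :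
    ∃ π : ProbabilityMeasure PointMeasure,
      IsPoissonPointProcess (fun m : PointMeasure => m) (π : Measure PointMeasure) h := by
  set Λ := volume.withDensity fun x => ENNReal.ofReal (h x) with hΛ
  let P (ω : ℕ → Σ k : ℕ, Fin k → ℝ) : PointMeasure :=
    ⟨superposition ω, isLocallyFiniteMeasure_superposition ω,
      fun A hA => integerValued_superposition ω hA⟩
  have hP : Measurable P := PointMeasure.measurable_of_measurable_toMeasure measurable_superposition
  have : IsProbabilityMeasure (samplesLaw Λ) := by unfold samplesLaw; infer_instance
  refine ⟨⟨(samplesLaw Λ).map P, Measure.isProbabilityMeasure_map hP.aemeasurable⟩, ?_⟩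
  have : IsProbabilityMeasure ((samplesLaw Λ).map P) :=
    Measure.isProbabilityMeasure_map hP.aemeasurable
  change IsPoissonPointProcess _ ((samplesLaw Λ).map P) h
  refine isPoissonPointProcess_of_laplace measurable_id fun φ hφ => ?_
  rw [lintegral_map _ hP]
  · exact lintegral_negExp_superposition Λ hφ
  · exact negExp.measurable.comp ((Measure.measurable_lintegral hφ).comp
      PointMeasure.measurable_toMeasure)


/-! ### Truncated expansion of a product. -/

section Bonferroni

/-- Pascal's rule for elementary symmetric sums: sort the subsets by whether they contain `x`. -/
lemma sum_powersetCard_succ_insert {ι R : Type*} [DecidableEq ι] [CommSemiring R] (g : ι → R)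
    {s : Finset ι} {x : ι} (hx : x ∉ s) (k : ℕ) :
    ∑ t ∈ (insert x s).powersetCard (k + 1), ∏ i ∈ t, g i =
      ∑ t ∈ s.powersetCard (k + 1), ∏ i ∈ t, g i + g x * ∑ t ∈ s.powersetCard k, ∏ i ∈ t, g i := by
  have hmem {t : Finset ι} (ht : t ∈ s.powersetCard k) : x ∉ t := fun h =>
    hx ((Finset.mem_powersetCard.1 ht).1 h)
  rw [Finset.powersetCard_succ_insert hx, Finset.sum_union, Finset.sum_image, Finset.mul_sum]
  · exact congrArg _ (Finset.sum_congr rfl fun t ht => Finset.prod_insert (hmem ht))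
  · intro t ht t' ht' h
    rw [← Finset.erase_insert (hmem ht), h, Finset.erase_insert (hmem ht')]
  · refine Finset.disjoint_left.2 fun t ht ht' => ?_
    obtain ⟨t', -, rfl⟩ := Finset.mem_image.1 ht'
    exact hx ((Finset.mem_powersetCard.1 ht).1 (Finset.mem_insert_self _ _))

/-- **Bonferroni inequality**: the error made by truncating the expansion of a product of
contractions `1 + g i` into elementary symmetric sums is at most the next symmetric sum. -/
lemma norm_prod_one_add_sub_le {ι : Type*} (s : Finset ι) {g : ι → ℂ}
    (hg : ∀ i, ‖1 + g i‖ ≤ 1) (k : ℕ) :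
    ‖∏ i ∈ s, (1 + g i) - ∑ j ∈ Finset.range k, ∑ t ∈ s.powersetCard j, ∏ i ∈ t, g i‖ ≤
      ∑ t ∈ s.powersetCard k, ∏ i ∈ t, ‖g i‖ := by
  classical
  induction s using Finset.induction_on generalizing k with
  | empty =>
    cases k with
    | zero => simp
    | succ k =>
      have h (j : ℕ) : Finset.powersetCard (j + 1) (∅ : Finset ι) = ∅ :=
        Finset.powersetCard_eq_empty.2 (by simp)
      rw [Finset.sum_range_succ']
      simp [h]
  | insert x s hx ih =>
    cases k with
    | zero =>
      simp only [Finset.range_zero, Finset.sum_empty, sub_zero, Finset.powersetCard_zero,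
        Finset.sum_singleton, Finset.prod_empty, norm_prod]
      exact Finset.prod_le_one (fun _ _ => norm_nonneg _) fun i _ => hg i
    | succ k =>
      rw [sum_powersetCard_succ_insert _ hx, Finset.prod_insert hx, Finset.sum_range_succ']
      simp_rw [sum_powersetCard_succ_insert _ hx]
      have h1 := ih (k + 1)
      rw [Finset.sum_range_succ'] at h1
      have h2 := ih k
      rw [Finset.sum_add_distrib, ← Finset.mul_sum]
      simp only [Finset.powersetCard_zero, Finset.sum_singleton, Finset.prod_empty] at h1 ⊢
      set A := ∏ i ∈ s, (1 + g i)
      set X := ∑ j ∈ Finset.range k, ∑ t ∈ s.powersetCard (j + 1), ∏ i ∈ t, g i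
      set Y := ∑ j ∈ Finset.range k, ∑ t ∈ s.powersetCard j, ∏ i ∈ t, g i
      -- The error regroups into the errors for `s` at orders `k + 1` and `k`, and the bounds
      -- satisfy the same recursion.
      calc ‖(1 + g x) * A - (X + g x * Y + 1)‖ = ‖(A - (X + 1)) + g x * (A - Y)‖ := by ring_nf
        _ ≤ ‖A - (X + 1)‖ + ‖g x‖ * ‖A - Y‖ := (norm_add_le _ _).trans (by rw [norm_mul])
        _ ≤ _ := by gcongr

end Bonferroni

/-! ### Asymptotics of the centring. -/

section Asymptotics

/-- The centring constant `d log n - log (d!)`. -/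
noncomputable def centering (d n : ℕ) : ℝ := d * Real.log n - Real.log (d.factorial : ℝ)

lemma tendsto_log_pow_div (k : ℕ) : Tendsto (fun n : ℕ => Real.log n ^ k / n) atTop (𝓝 0) :=
  (Real.isLittleO_pow_log_id_atTop (n := k)).tendsto_div_nhds_zero.comp tendsto_natCast_atTop_atTop

lemma tendsto_centering_div (d : ℕ) (y : ℝ) :
    Tendsto (fun n : ℕ => (y + centering d n) / n) atTop (𝓝 0) := by
  have h0 := tendsto_log_pow_div 0
  have h1 := tendsto_log_pow_div 1
  have := (h0.const_mul (y - Real.log (d.factorial : ℝ))).add (h1.const_mul (d : ℝ))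
  simp only [mul_zero, add_zero] at this
  refine this.congr fun n => ?_
  simp only [centering]
  ring

lemma tendsto_mul_centering_div_sq (d : ℕ) (y : ℝ) :
    Tendsto (fun n : ℕ => (n : ℝ) * ((y + centering d n) / n) ^ 2) atTop (𝓝 0) := by
  have h0 := tendsto_log_pow_div 0
  have h1 := tendsto_log_pow_div 1
  have h2 := tendsto_log_pow_div 2
  set c := y - Real.log (d.factorial : ℝ) with hc
  have := ((h0.const_mul (c ^ 2)).add (h1.const_mul (2 * c * d))).add (h2.const_mul ((d : ℝ) ^ 2))
  simp only [mul_zero, add_zero] at this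
  refine this.congr' ?_
  filter_upwards [eventually_gt_atTop 0] with n hn
  have hn' : (n : ℝ) ≠ 0 := by positivity
  simp only [centering]
  have : y = c + Real.log (d.factorial : ℝ) := by rw [hc]; ring
  rw [this]
  field_simp
  ring

lemma eventually_centering_nonneg {d : ℕ} (hd : 1 ≤ d) (y : ℝ) :
    ∀ᶠ n : ℕ in atTop, 0 ≤ (y + centering d n) / n := by
  have h1 : Tendsto (fun n : ℕ => (d : ℝ) * Real.log n) atTop atTop :=
    (Real.tendsto_log_atTop.comp tendsto_natCast_atTop_atTop).const_mul_atTop (by positivity)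
  filter_upwards [h1.eventually_ge_atTop (Real.log (d.factorial : ℝ) - y)] with n hn
  simp only [centering]
  exact div_nonneg (by linarith) (by positivity)

/-- With `z = (y + centering d n) / n`, one has `log (1 - z) = -z + O(z²)` and `n z² → 0`, while `n
z = y + d log n - log d!` cancels the factor `n^d`. The shift by `j` is harmless because `log (1 -
z) → 0`. -/
lemma tendsto_pow_mul_one_sub_pow (d j : ℕ) (y : ℝ) :
    Tendsto (fun n : ℕ => (n : ℝ) ^ d * (1 - (y + centering d n) / n) ^ (n - j)) atTop
      (𝓝 (d.factorial * Real.exp (-y))) := by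
  set z : ℕ → ℝ := fun n => (y + centering d n) / n with hz
  have hz0 : Tendsto z atTop (𝓝 0) := tendsto_centering_div d y
  have habs : Tendsto (fun n => |z n|) atTop (𝓝 0) := by simpa using hz0.abs
  have hlog : Tendsto (fun n => Real.log (1 - z n)) atTop (𝓝 0) := by
    have : Tendsto (fun n => Real.log (1 - z n)) atTop (𝓝 (Real.log (1 - 0))) :=
      (hz0.const_sub 1).log (by norm_num)
    simpa using this
  have hrem : Tendsto (fun n : ℕ => n * (z n + Real.log (1 - z n))) atTop (𝓝 0) := by
    have hb : Tendsto (fun n : ℕ => 2 * ((n : ℝ) * z n ^ 2)) atTop (𝓝 0) := by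
      simpa using (tendsto_mul_centering_div_sq d y).const_mul 2
    refine squeeze_zero_norm' ?_ hb
    filter_upwards [habs.eventually_le_const (show (0 : ℝ) < 1 / 2 by norm_num)] with n hn
    have h1 := Real.abs_log_sub_add_sum_range_le (hn.trans_lt (by norm_num)) 1
    simp only [Finset.sum_range_one, zero_add, pow_one, Nat.cast_zero, div_one, Nat.reduceAdd,
      sq_abs] at h1
    rw [norm_mul, Real.norm_natCast, Real.norm_eq_abs]
    have h2 : z n ^ 2 / (1 - |z n|) ≤ 2 * z n ^ 2 := by
      rw [div_le_iff₀ (by linarith)]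
      nlinarith [sq_nonneg (z n)]
    calc (n : ℝ) * |z n + Real.log (1 - z n)| ≤ n * (2 * z n ^ 2) := by gcongr; exact h1.trans h2
      _ = _ := by ring
  have hexp : Tendsto (fun n : ℕ => Real.exp ((-y + Real.log (d.factorial : ℝ)) +
      n * (z n + Real.log (1 - z n)) - j * Real.log (1 - z n))) atTop
      (𝓝 (d.factorial * Real.exp (-y))) := by
    have h1 := ((hrem.const_add (-y + Real.log (d.factorial : ℝ))).sub (hlog.const_mul (j : ℝ)))
    have h2 := (Real.continuous_exp.tendsto _).comp h1
    refine h2.trans_eq (congrArg _ ?_)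
    rw [mul_zero, sub_zero, add_zero, Real.exp_add, Real.exp_log (by positivity), mul_comm]
  refine hexp.congr' ?_
  filter_upwards [eventually_gt_atTop 0, eventually_ge_atTop j,
    habs.eventually_le_const (show (0 : ℝ) < 1 / 2 by norm_num)] with n hn hj hzn
  have hn' : (0 : ℝ) < n := by exact_mod_cast hn
  have hpos : 0 < 1 - z n := by linarith [le_abs_self (z n)]
  have h1 : (n : ℝ) ^ d = Real.exp (d * Real.log n) := by
    rw [Real.exp_nat_mul, Real.exp_log hn']
  have h2 : (1 - z n) ^ (n - j) = Real.exp (((n : ℝ) - j) * Real.log (1 - z n)) := by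
    rw [← Nat.cast_sub hj, Real.exp_nat_mul, Real.exp_log hpos]
  have h3 : (n : ℝ) * z n = y + d * Real.log n - Real.log (d.factorial : ℝ) := by
    simp only [hz, centering]
    field_simp
    ring
  change _ = (n : ℝ) ^ d * (1 - z n) ^ (n - j)
  rw [h1, h2, ← Real.exp_add]
  congr 1
  linear_combination h3

end Asymptotics


/-! ### The rescaled density of a minimum of uniform variables. -/

/-- The density of the minimum of `m` independent uniform random variables on `[0, 1]`. -/
noncomputable def minDensity (m : ℕ) : ℝ → ℝ :=
  (Set.Icc 0 1).indicator fun x => m * (1 - x) ^ (m - 1)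

lemma measurable_minDensity (m : ℕ) : Measurable (minDensity m) :=
  Measurable.indicator (by fun_prop) measurableSet_Icc

lemma minDensity_nonneg (m : ℕ) (x : ℝ) : 0 ≤ minDensity m x :=
  Set.indicator_nonneg (fun x hx => mul_nonneg (by positivity)
    (pow_nonneg (by linarith [hx.2]) _)) x

/-- The rescaled density of the minimum, as a density on the line. -/
noncomputable def scaledDensity (d j n : ℕ) (y : ℝ) : ℝ :=
  (n : ℝ) ^ d * ((n : ℝ)⁻¹ * minDensity (n - j) ((y + centering d n) / n))

lemma tendsto_natCast_sub_div (j : ℕ) :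
    Tendsto (fun n : ℕ => ((n - j : ℕ) : ℝ) / n) atTop (𝓝 1) := by
  have h : Tendsto (fun n : ℕ => 1 - (j : ℝ) / n) atTop (𝓝 (1 - 0)) :=
    (tendsto_const_div_atTop_nhds_zero_nat (j : ℝ)).const_sub 1
  rw [sub_zero] at h
  refine h.congr' ?_
  filter_upwards [eventually_gt_atTop 0, eventually_ge_atTop j] with n hn hj
  have : (n : ℝ) ≠ 0 := by positivity
  rw [Nat.cast_sub hj]
  field_simp

lemma tendsto_scaledDensity {d : ℕ} (hd : 1 ≤ d) (j : ℕ) (y : ℝ) :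
    Tendsto (fun n => scaledDensity d j n y) atTop (𝓝 (d.factorial * Real.exp (-y))) := by
  have h := (tendsto_natCast_sub_div j).mul (tendsto_pow_mul_one_sub_pow d (j + 1) y)
  rw [one_mul] at h
  refine h.congr' ?_
  filter_upwards [eventually_centering_nonneg hd y,
    (tendsto_centering_div d y).eventually_le_const zero_lt_one] with n h0 h1
  rw [scaledDensity, minDensity, Set.indicator_of_mem (Set.mem_Icc.2 ⟨h0, h1⟩), Nat.sub_sub]
  ring

/-- The density of the minimum decreases on `[0, 1]`, so its value at the left end `a` controls all
`y ≥ a` at once, as dominated convergence requires. The absolute value keeps the bound non-negative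
for every `n`. -/
lemma norm_scaledDensity_le {d j n : ℕ} {a y : ℝ} (hay : a ≤ y) :
    ‖scaledDensity d j n y‖ ≤
      (n : ℝ) ^ d * |1 - (a + centering d n) / n| ^ (n - (j + 1)) := by
  have hnonneg : 0 ≤ scaledDensity d j n y :=
    mul_nonneg (by positivity) (mul_nonneg (by positivity) (minDensity_nonneg _ _))
  rw [Real.norm_of_nonneg hnonneg, scaledDensity]
  gcongr
  by_cases h : (y + centering d n) / n ∈ Set.Icc (0 : ℝ) 1
  · rw [minDensity, Set.indicator_of_mem h, Nat.sub_sub, ← mul_assoc]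
    have h1 : (n : ℝ)⁻¹ * (n - j : ℕ) ≤ 1 := by
      rw [inv_mul_eq_div]
      exact div_le_one_of_le₀ (by exact_mod_cast Nat.sub_le _ _) (by positivity)
    have h2 : 1 - (y + centering d n) / n ≤ |1 - (a + centering d n) / n| := by
      refine le_trans ?_ (le_abs_self _)
      gcongr
    have h3 : 0 ≤ 1 - (y + centering d n) / n := by linarith [h.2]
    calc _ ≤ 1 * (1 - (y + centering d n) / n) ^ (n - (j + 1)) := by gcongr
      _ ≤ _ := by rw [one_mul]; gcongr
  · rw [minDensity, Set.indicator_of_notMem h, mul_zero]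
    positivity

/-- The substitution `y = n x - centering d n` turns the integral into one against `scaledDensity`.
Since `g` vanishes far to the left, dominated convergence applies. -/
lemma tendsto_pow_mul_integral_minDensity {d : ℕ} (hd : 1 ≤ d) (j : ℕ) {g : ℝ → ℂ}
    (hg : Continuous g) (hcs : HasCompactSupport g) :
    Tendsto (fun n : ℕ => (n : ℂ) ^ d *
      ∫ x, (minDensity (n - j) x : ℂ) * g (n * x - centering d n)) atTop
      (𝓝 (d.factorial * ∫ y, (Real.exp (-y) : ℂ) * g y)) := by
  obtain ⟨R, hR⟩ := hcs.isCompact.isBounded.subset_closedBall 0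
  have hg0 : ∀ y, y < -R → g y = 0 := fun y hy => by
    by_contra h
    have := hR (subset_tsupport _ (Function.mem_support.2 h))
    simp at this
    linarith [neg_abs_le y]
  have hint : Tendsto (fun n : ℕ => ∫ y, (scaledDensity d j n y : ℂ) * g y) atTop
      (𝓝 (∫ y, ((d.factorial * Real.exp (-y) : ℝ) : ℂ) * g y)) := by
    have hb : ∀ᶠ n : ℕ in atTop, (n : ℝ) ^ d * |1 - (-R + centering d n) / n| ^ (n - (j + 1)) ≤
        |d.factorial * Real.exp (- -R)| + 1 := by
      have h1 := (tendsto_pow_mul_one_sub_pow d (j + 1) (-R)).abs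
      filter_upwards [h1.eventually_le_const (lt_add_one _)] with n hn
      rwa [abs_mul, abs_pow, abs_pow, abs_of_nonneg (Nat.cast_nonneg n)] at hn
    refine tendsto_integral_filter_of_dominated_convergence
      (fun y => (|d.factorial * Real.exp (- -R)| + 1) * ‖g y‖) (.of_forall fun n => ?_) ?_
      ((hg.integrable_of_hasCompactSupport hcs).norm.const_mul _) (.of_forall fun y => ?_)
    · have h1 : Measurable (scaledDensity d j n) := by
        have := measurable_minDensity (n - j)
        unfold scaledDensity
        fun_prop
      exact (Measurable.mul (by fun_prop) hg.measurable).aestronglyMeasurable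
    · filter_upwards [hb] with n hn
      refine .of_forall fun y => ?_
      rw [norm_mul, Complex.norm_real]
      by_cases hy : y < -R
      · simp [hg0 y hy]
      · gcongr
        exact (norm_scaledDensity_le (not_lt.1 hy)).trans hn
    · exact ((Complex.continuous_ofReal.tendsto _).comp
        (tendsto_scaledDensity hd j y)).mul_const _
  have hlim : ∫ y, ((d.factorial * Real.exp (-y) : ℝ) : ℂ) * g y =
      d.factorial * ∫ y, (Real.exp (-y) : ℂ) * g y := by
    rw [← integral_const_mul]
    congr with y
    push_cast
    ring
  rw [← hlim]
  refine hint.congr' ?_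
  filter_upwards [eventually_gt_atTop 0] with n hn
  have hn' : (n : ℝ) ≠ 0 := by positivity
  have h1 := Measure.integral_comp_div
    (fun x => (minDensity (n - j) x : ℂ) * g (n * x - centering d n)) (n : ℝ)
  rw [← integral_add_right_eq_self _ (centering d n)] at h1
  have h2 : ∫ x, (minDensity (n - j) x : ℂ) * g (n * x - centering d n) =
      (n : ℂ)⁻¹ * ∫ y, (minDensity (n - j) ((y + centering d n) / n) : ℂ) * g y := by
    have h3 (y : ℝ) : (n : ℝ) * ((y + centering d n) / n) - centering d n = y := by
      field_simp; ring
    simp_rw [h3] at h1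
    rw [h1, Nat.abs_cast, Complex.real_smul, ← mul_assoc]
    simp [hn.ne']
  rw [h2, ← integral_const_mul, ← integral_const_mul]
  congr with y
  simp only [scaledDensity]
  push_cast
  ring


/-! ### Minima of independent uniform variables. -/

/-- The least value of `w` on the finite set `B`. -/
noncomputable def minOver {T : Type*} (B : Finset T) (w : T → ℝ) : ℝ := ⨅ t : B, w t

section MinOver

variable {T : Type*} {B : Finset T} {w : T → ℝ}

lemma le_minOver_iff (hB : B.Nonempty) {a : ℝ} : a ≤ minOver B w ↔ ∀ t ∈ B, a ≤ w t := by
  have : Nonempty B := hB.to_subtype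
  rw [minOver, le_ciInf_iff (Set.finite_range _).bddBelow]
  simp

lemma minOver_le {t : T} (ht : t ∈ B) : minOver B w ≤ w t :=
  ciInf_le (Set.finite_range fun t : B => w t).bddBelow ⟨t, ht⟩

lemma minOver_anti {B' : Finset T} (hB : B.Nonempty) (h : B ⊆ B') :
    minOver B' w ≤ minOver B w :=
  (le_minOver_iff hB).2 fun _ ht => minOver_le (h ht)

lemma lt_minOver_iff (hB : B.Nonempty) {a : ℝ} : a < minOver B w ↔ ∀ t ∈ B, a < w t := by
  have : Nonempty B := hB.to_subtype
  refine ⟨fun h t ht => h.trans_le (minOver_le ht), fun h => ?_⟩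
  obtain ⟨t, ht⟩ := exists_eq_ciInf_of_finite (f := fun t : B => w t)
  rw [minOver, ← ht]
  exact h t t.2

lemma measurable_minOver (B : Finset T) : Measurable (minOver B) :=
  Measurable.iInf fun t => measurable_pi_apply t.1

end MinOver

section Uniform

variable {Ω T : Type*} [MeasurableSpace Ω] {μ : Measure Ω} {W : T → Ω → ℝ}

/-- Disjoint blocks of a family of independent random variables are independent. -/
lemma iIndepFun_blocks {ι : Type*} (hW : iIndepFun W μ) (hm : ∀ t, Measurable (W t))
    {B : ι → Finset T} (hB : Pairwise (Function.onFun Disjoint B)) :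
    iIndepFun (fun i ω (t : B i) => W t ω) μ := by
  have hP := hW.isProbabilityMeasure
  have hP' (t : T) : IsProbabilityMeasure (μ.map (W t)) :=
    Measure.isProbabilityMeasure_map (hm t).aemeasurable
  let e (p : Σ i, B i) : T := p.2
  have he : Function.Injective e := by
    rintro ⟨i, t, ht⟩ ⟨i', t', ht'⟩ h
    have h' : t = t' := h
    subst h'
    have : i = i' := by
      by_contra hii
      exact Finset.disjoint_left.1 (hB hii) ht ht'
    subst this
    rfl
  have h1 := (iIndepFun_iff_map_fun_eq_infinitePi_map fun p => hm (e p)).1 (hW.precomp he)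
  have h2 (i : ι) := (iIndepFun_iff_map_fun_eq_infinitePi_map fun t : B i => hm t).1
    (hW.precomp (g := fun t : B i => (t : T)) Subtype.val_injective)
  have hm' (i : ι) : Measurable fun ω (t : B i) => W t ω := measurable_pi_lambda _ fun t => hm t
  rw [iIndepFun_iff_map_fun_eq_infinitePi_map hm']
  have h3 := congrArg (Measure.map (MeasurableEquiv.piCurry fun (i : ι) (_ : B i) => ℝ)) h1
  rw [Measure.infinitePi_map_piCurry (fun i (t : B i) => μ.map (W t)),
    Measure.map_map (MeasurableEquiv.measurable _) (measurable_pi_lambda _ fun p => hm (e p))] at h3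
  simp_rw [← h2] at h3
  exact h3

lemma measure_le_of_isUniform {X : Ω → ℝ} (hX : Measurable X)
    (hu : pdf.IsUniform X (Set.Icc 0 1) μ volume) (a : ℝ) :
    μ {ω | a ≤ X ω} = ENNReal.ofReal (1 - max a 0) := by
  have h1 : μ {ω | a ≤ X ω} = μ.map X (Set.Ici a) := (Measure.map_apply hX measurableSet_Ici).symm
  rw [h1, hu, ProbabilityTheory.cond_apply measurableSet_Icc]
  have : Set.Icc (0 : ℝ) 1 ∩ Set.Ici a = Set.Icc (max a 0) 1 := by
    ext x
    simp only [Set.mem_inter_iff, Set.mem_Icc, Set.mem_Ici, max_le_iff]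
    tauto
  rw [this]
  simp

lemma measure_ge_of_isUniform {X : Ω → ℝ} (hX : Measurable X)
    (hu : pdf.IsUniform X (Set.Icc 0 1) μ volume) (u : ℝ) :
    μ {ω | X ω ≤ u} ≤ ENNReal.ofReal u := by
  have h1 : μ {ω | X ω ≤ u} = μ.map X (Set.Iic u) := (Measure.map_apply hX measurableSet_Iic).symm
  rw [h1, hu, ProbabilityTheory.cond_apply measurableSet_Icc]
  have : Set.Icc (0 : ℝ) 1 ∩ Set.Iic u ⊆ Set.Icc 0 u := fun x hx => ⟨hx.1.1, hx.2⟩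
  simpa using measure_mono (μ := volume) this

lemma measure_forall_le (hW : iIndepFun W μ) (hm : ∀ t, Measurable (W t))
    (hu : ∀ t, pdf.IsUniform (W t) (Set.Icc 0 1) μ volume) (B : Finset T) (a : ℝ) :
    μ {ω | ∀ t ∈ B, a ≤ W t ω} = ENNReal.ofReal (1 - max a 0) ^ B.card := by
  have h1 := hW.measure_inter_preimage_eq_mul B (sets := fun _ => Set.Ici a)
    fun _ _ => measurableSet_Ici
  have h2 : {ω | ∀ t ∈ B, a ≤ W t ω} = ⋂ t ∈ B, W t ⁻¹' Set.Ici a := by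
    ext ω; simp
  rw [h2, h1, ← Finset.prod_const]
  exact Finset.prod_congr rfl fun t _ => measure_le_of_isUniform (hm t) (hu t) a

lemma withDensity_minDensity_Ici {m : ℕ} (hm : 0 < m) (a : ℝ) :
    volume.withDensity (fun x => ENNReal.ofReal (minDensity m x)) (Set.Ici a) =
      ENNReal.ofReal (1 - max a 0) ^ m := by
  rw [withDensity_apply _ measurableSet_Ici]
  have h1 : (fun x => ENNReal.ofReal (minDensity m x)) =
      (Set.Icc 0 1).indicator fun x => ENNReal.ofReal (m * (1 - x) ^ (m - 1)) := by
    ext x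
    by_cases hx : x ∈ Set.Icc (0 : ℝ) 1 <;> simp [minDensity, hx]
  have h2 : Set.Icc (0 : ℝ) 1 ∩ Set.Ici a = Set.Icc (max a 0) 1 := by
    ext x
    simp only [Set.mem_inter_iff, Set.mem_Icc, Set.mem_Ici, max_le_iff]
    tauto
  rw [h1, lintegral_indicator measurableSet_Icc, Measure.restrict_restrict measurableSet_Icc, h2]
  have hb : 0 ≤ max a 0 := le_max_right _ _
  set b := max a 0
  rcases le_or_gt b 1 with h | h
  · rw [← ofReal_integral_eq_lintegral_ofReal, integral_Icc_eq_integral_Ioc,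
      ← intervalIntegral.integral_of_le h, ← ENNReal.ofReal_pow (by linarith)]
    · congr 1
      have hderiv (x : ℝ) : HasDerivAt (fun x : ℝ => -(1 - x) ^ m) (m * (1 - x) ^ (m - 1)) x := by
        have := (((hasDerivAt_id x).const_sub 1).pow m).neg
        exact this.congr_deriv (by simp)
      rw [intervalIntegral.integral_eq_sub_of_hasDerivAt fun x _ => hderiv x]
      · simp [hm.ne']
      · exact Continuous.intervalIntegrable (by fun_prop) _ _
    · exact Continuous.integrableOn_Icc (by fun_prop)
    · refine (ae_restrict_mem measurableSet_Icc).mono fun x hx => ?_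
      exact mul_nonneg (by positivity) (pow_nonneg (by linarith [hx.2]) _)
  · rw [Set.Icc_eq_empty (not_le.2 h), ENNReal.ofReal_of_nonpos (by linarith), zero_pow hm.ne']
    simp

/-- The laws are compared on the half-lines `[a, ∞)`, where the event for a minimum is an
intersection of independent events. -/
lemma map_minOver (hW : iIndepFun W μ) (hm : ∀ t, Measurable (W t))
    (hu : ∀ t, pdf.IsUniform (W t) (Set.Icc 0 1) μ volume) {B : Finset T} (hB : B.Nonempty) :
    μ.map (fun ω => minOver B fun t => W t ω) =
      volume.withDensity fun x => ENNReal.ofReal (minDensity B.card x) := by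
  have hmeas : Measurable fun ω => minOver B fun t => W t ω :=
    (measurable_minOver B).comp (measurable_pi_lambda _ hm)
  have hP := hW.isProbabilityMeasure
  have := Measure.isProbabilityMeasure_map (μ := μ) hmeas.aemeasurable
  refine Measure.ext_of_Ici _ _ fun a => ?_
  rw [withDensity_minDensity_Ici hB.card_pos, Measure.map_apply hmeas measurableSet_Ici,
    ← measure_forall_le hW hm hu]
  congr 1
  ext ω
  exact le_minOver_iff hB

lemma integral_minOver (hW : iIndepFun W μ) (hm : ∀ t, Measurable (W t))
    (hu : ∀ t, pdf.IsUniform (W t) (Set.Icc 0 1) μ volume) {B : Finset T} (hB : B.Nonempty)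
    {G : ℝ → ℂ} (hG : Measurable G) :
    ∫ ω, G (minOver B fun t => W t ω) ∂μ = ∫ x, (minDensity B.card x : ℂ) * G x := by
  have hmeas : Measurable fun ω => minOver B fun t => W t ω :=
    (measurable_minOver B).comp (measurable_pi_lambda _ hm)
  rw [← integral_map hmeas.aemeasurable hG.aestronglyMeasurable, map_minOver hW hm hu hB,
    integral_withDensity_eq_integral_toReal_smul (measurable_minDensity _).ennreal_ofReal
      (.of_forall fun _ => ENNReal.ofReal_lt_top)]
  congr with x
  rw [ENNReal.toReal_ofReal (minDensity_nonneg _ _), Complex.real_smul]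

lemma integral_prod_minOver_blocks {F : Type*} {S : Finset F} (hW : iIndepFun W μ)
    (hm : ∀ t, Measurable (W t))
    (hunif : ∀ t, pdf.IsUniform (W t) (Set.Icc 0 1) μ volume) {B : F → Finset T} {m : ℕ}
    (hm0 : 0 < m) (hB : ∀ σ ∈ S, (B σ).card = m)
    (hd : ∀ σ ∈ S, ∀ σ' ∈ S, σ ≠ σ' → Disjoint (B σ) (B σ')) {G : ℝ → ℂ} (hG : Measurable G) :
    ∫ ω, ∏ σ ∈ S, G (minOver (B σ) fun t => W t ω) ∂μ =
      (∫ x, (minDensity m x : ℂ) * G x) ^ S.card := by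
  have h1 : iIndepFun (fun (σ : S) ω (t : B σ) => W t ω) μ :=
    iIndepFun_blocks hW hm fun σ σ' h => hd σ σ.2 σ' σ'.2 fun h' => h (Subtype.ext h')
  have h2 := h1.integral_fun_prod_comp (𝕜 := ℂ) (f := fun σ x => G (⨅ t, x t))
    (fun σ => (measurable_pi_lambda _ fun t : B σ => hm t).aemeasurable)
    (fun σ => (hG.comp (Measurable.iInf fun t => measurable_pi_apply t)).aestronglyMeasurable)
  have h3 (σ : S) : ∫ ω, G (⨅ t : B σ, W t ω) ∂μ = ∫ x, (minDensity m x : ℂ) * G x := by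
    have := integral_minOver hW hm hunif (B := B σ)
      (Finset.card_pos.1 (by rw [hB σ σ.2]; exact hm0)) hG
    rwa [hB σ σ.2] at this
  simp_rw [h3] at h2
  rw [Finset.prod_const, Finset.card_univ, Fintype.card_coe] at h2
  rw [← h2]
  congr with ω
  exact (Finset.prod_coe_sort S fun σ => G (minOver (B σ) fun t => W t ω)).symm

end Uniform


/-! ### Replacing overlapping stars by disjoint blocks. -/

section Stars

variable {F T : Type*} [DecidableEq T] {S : Finset F} {star : F → Finset T} {N : ℕ}

/-- Finitely many sets of equal size with small pairwise intersections contain disjoint subsets of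
nearly the same size. -/
lemma exists_disjoint_blocks (hN : ∀ σ ∈ S, (star σ).card = N)
    (hinter : ∀ σ ∈ S, ∀ σ' ∈ S, σ ≠ σ' → (star σ ∩ star σ').card ≤ 1) :
    ∃ B : F → Finset T, (∀ σ ∈ S, B σ ⊆ star σ ∧ (B σ).card = N - S.card) ∧
      ∀ σ ∈ S, ∀ σ' ∈ S, σ ≠ σ' → Disjoint (B σ) (star σ') := by
  classical
  -- Removing the overlaps with fewer than `S.card` other stars, each of at most one element, leaves
  -- enough points to select exactly `N - S.card`. The block then avoids the whole of every other
  -- star, which later separates the leftover points from the blocks.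
  have h (σ : F) (hσ : σ ∈ S) : ∃ B ⊆ star σ \ (S.erase σ).biUnion (fun σ' => star σ ∩ star σ'),
      B.card = N - S.card := by
    refine Finset.exists_subset_card_eq ?_
    have h1 : ((S.erase σ).biUnion fun σ' => star σ ∩ star σ').card ≤ (S.erase σ).card * 1 :=
      Finset.card_biUnion_le_card_mul _ _ _ fun σ' hσ' =>
        hinter σ hσ σ' (Finset.mem_of_mem_erase hσ') (Finset.ne_of_mem_erase hσ').symm
    have h2 := Finset.le_card_sdiff ((S.erase σ).biUnion fun σ' => star σ ∩ star σ') (star σ)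
    have h3 : (S.erase σ).card ≤ S.card := Finset.card_erase_le
    rw [hN σ hσ] at h2
    omega
  choose! B hB hBcard using h
  refine ⟨B, fun σ hσ => ⟨(hB σ hσ).trans Finset.sdiff_subset, hBcard σ hσ⟩,
    fun σ hσ σ' hσ' hne => Finset.disjoint_left.2 fun t ht ht' => ?_⟩
  have h1 := Finset.mem_sdiff.1 (hB σ hσ ht)
  exact h1.2 (Finset.mem_biUnion.2 ⟨σ', Finset.mem_erase.2 ⟨hne.symm, hσ'⟩,
    Finset.mem_inter.2 ⟨h1.1, ht'⟩⟩)

/-- If the values outside the blocks exceed `u`, the products over stars and over blocks agree; in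
general they differ by at most `2 C ^ k`, and only if no block has a value below `l`. -/
lemma norm_prod_minOver_sub_le {B : F → Finset T} (hBs : ∀ σ ∈ S, B σ ⊆ star σ)
    (hBne : ∀ σ ∈ S, (B σ).Nonempty) {G : ℝ → ℂ} {C l u : ℝ} (hC : ∀ x, ‖G x‖ ≤ C)
    (hl : ∀ x, x < l → G x = 0) (hu : ∀ x, u < x → G x = 0) (w : T → ℝ) :
    ‖∏ σ ∈ S, G (minOver (star σ) w) - ∏ σ ∈ S, G (minOver (B σ) w)‖ ≤
      {w : T → ℝ | (∃ t ∈ S.biUnion (fun σ => star σ \ B σ), w t ≤ u) ∧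
        ∀ t ∈ S.biUnion B, l ≤ w t}.indicator (fun _ => 2 * C ^ S.card) w := by
  have hC0 : 0 ≤ C := (norm_nonneg _).trans (hC 0)
  by_cases h1 : ∃ t ∈ S.biUnion (fun σ => star σ \ B σ), w t ≤ u
  · by_cases h2 : ∀ t ∈ S.biUnion B, l ≤ w t
    · rw [Set.indicator_of_mem (by exact ⟨h1, h2⟩), two_mul]
      refine (norm_sub_le _ _).trans (add_le_add ?_ ?_) <;>
      · rw [norm_prod]
        exact (Finset.prod_le_prod (fun _ _ => norm_nonneg _) fun _ _ => hC _).trans_eq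
            (Finset.prod_const _)
    -- A value below `l` in one block pulls the minima over that block and over its star below `l`,
    -- so both products vanish.
    · rw [Set.indicator_of_notMem fun h => h2 h.2]
      push Not at h2
      obtain ⟨t, ht, htl⟩ := h2
      obtain ⟨σ, hσ, htσ⟩ := Finset.mem_biUnion.1 ht
      rw [Finset.prod_eq_zero hσ (hl _ ((minOver_le (hBs σ hσ htσ)).trans_lt htl)),
        Finset.prod_eq_zero hσ (hl _ ((minOver_le htσ).trans_lt htl)), sub_zero, norm_zero]
  · rw [Set.indicator_of_notMem fun h => h1 h.1]
    push Not at h1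
    have : ∀ σ ∈ S, G (minOver (star σ) w) = G (minOver (B σ) w) := by
      intro σ hσ
      have hout : ∀ t ∈ star σ, t ∉ B σ → u < w t := fun t ht ht' =>
        h1 t (Finset.mem_biUnion.2 ⟨σ, hσ, Finset.mem_sdiff.2 ⟨ht, ht'⟩⟩)
      have hsne : (star σ).Nonempty := (hBne σ hσ).mono (hBs σ hσ)
      -- If the block minimum is at most `u`, the outer values cannot lower it; otherwise both
      -- minima exceed `u` and `G` vanishes at both.
      rcases le_or_gt (minOver (B σ) w) u with hle | hlt
      · congr 1
        refine le_antisymm (minOver_anti (hBne σ hσ) (hBs σ hσ)) ((le_minOver_iff hsne).2 ?_)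
        intro t ht
        by_cases htB : t ∈ B σ
        · exact minOver_le htB
        · exact hle.trans (hout t ht htB).le
      · rw [hu _ hlt, hu _ ((lt_minOver_iff hsne).2 fun t ht => ?_)]
        by_cases htB : t ∈ B σ
        · exact hlt.trans_le (minOver_le htB)
        · exact hout t ht htB
    rw [Finset.prod_congr rfl this, sub_self, norm_zero]

variable {Ω : Type*} [MeasurableSpace Ω] {μ : Measure Ω} {W : T → Ω → ℝ}

/-- The products differ only if some leftover point has value at most `u` while all block points
have values at least `l`. These events concern disjoint sets of variables, so their probabilities
multiply. In the application the second factor offsets the number of `S.card`-element sets of faces,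
and the first makes the total error vanish. -/
lemma norm_integral_prod_minOver_sub_le (hW : iIndepFun W μ) (hm : ∀ t, Measurable (W t))
    (hunif : ∀ t, pdf.IsUniform (W t) (Set.Icc 0 1) μ volume)
    (hN : ∀ σ ∈ S, (star σ).card = N)
    (hinter : ∀ σ ∈ S, ∀ σ' ∈ S, σ ≠ σ' → (star σ ∩ star σ').card ≤ 1) (hk : S.card < N)
    {G : ℝ → ℂ} (hG : Measurable G) {C l u : ℝ} (hC : ∀ x, ‖G x‖ ≤ C)
    (hl : ∀ x, x < l → G x = 0) (hu : ∀ x, u < x → G x = 0) (hl0 : 0 ≤ l) (hl1 : l ≤ 1)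
    (hu0 : 0 ≤ u) :
    ‖∫ ω, ∏ σ ∈ S, G (minOver (star σ) fun t => W t ω) ∂μ -
        (∫ x, (minDensity (N - S.card) x : ℂ) * G x) ^ S.card‖ ≤
      2 * C ^ S.card * (S.card ^ 2 * u * ((1 - l) ^ (N - S.card)) ^ S.card) := by
  have hP := hW.isProbabilityMeasure
  have hC0 : 0 ≤ C := (norm_nonneg _).trans (hC 0)
  obtain ⟨B, hB, hd'⟩ := exists_disjoint_blocks hN hinter
  have hd : ∀ σ ∈ S, ∀ σ' ∈ S, σ ≠ σ' → Disjoint (B σ) (B σ') := fun σ hσ σ' hσ' h =>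
    (hd' σ hσ σ' hσ' h).mono_right (hB σ' hσ').1
  have hBne : ∀ σ ∈ S, (B σ).Nonempty := fun σ hσ =>
    Finset.card_pos.1 (by rw [(hB σ hσ).2]; omega)
  rw [← integral_prod_minOver_blocks hW hm hunif (by omega) (fun σ hσ => (hB σ hσ).2) hd hG]
  have hint (A : F → Finset T) :
      Integrable (fun ω => ∏ σ ∈ S, G (minOver (A σ) fun t => W t ω)) μ := by
    refine Integrable.of_bound (C := C ^ S.card) ?_ (.of_forall fun ω => ?_)
    · have (σ : F) : Measurable fun ω => G (minOver (A σ) fun t => W t ω) :=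
        hG.comp ((measurable_minOver _).comp (measurable_pi_lambda _ hm))
      exact (Finset.measurable_fun_prod _ fun σ _ => this σ).aestronglyMeasurable
    · rw [norm_prod]
      exact (Finset.prod_le_prod (fun _ _ => norm_nonneg _) fun _ _ => hC _).trans_eq
            (Finset.prod_const _)
  set R := S.biUnion fun σ => star σ \ B σ
  set U := S.biUnion B
  set E : Set (T → ℝ) := {w | (∃ t ∈ R, w t ≤ u) ∧ ∀ t ∈ U, l ≤ w t}
  let E₁ : Set (R → ℝ) := {x | ∃ t, x t ≤ u}
  let E₂ : Set (U → ℝ) := {x | ∀ t, l ≤ x t}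
  have hE₁ : MeasurableSet E₁ := by
    have : E₁ = ⋃ t, {x | x t ≤ u} := by ext; simp [E₁]
    rw [this]
    exact .iUnion fun t => measurableSet_le (measurable_pi_apply t) measurable_const
  have hE₂ : MeasurableSet E₂ := by
    have : E₂ = ⋂ t, {x | l ≤ x t} := by ext; simp [E₂]
    rw [this]
    exact .iInter fun t => measurableSet_le measurable_const (measurable_pi_apply t)
  have hpre : (fun ω t => W t ω) ⁻¹' E = (fun ω (t : R) => W t ω) ⁻¹' E₁ ∩
      (fun ω (t : U) => W t ω) ⁻¹' E₂ := by
    ext ω; simp [E, E₁, E₂]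
  have hE : MeasurableSet ((fun ω t => W t ω) ⁻¹' E) := by
    rw [hpre]
    exact ((measurable_pi_lambda _ fun t : R => hm t) hE₁).inter
      ((measurable_pi_lambda _ fun t : U => hm t) hE₂)
  have hRU : Disjoint R U := by
    refine Finset.disjoint_left.2 fun t htR htU => ?_
    obtain ⟨σ, hσ, htσ⟩ := Finset.mem_biUnion.1 htR
    obtain ⟨σ', hσ', htσ'⟩ := Finset.mem_biUnion.1 htU
    rw [Finset.mem_sdiff] at htσ
    rcases eq_or_ne σ' σ with rfl | hne
    · exact htσ.2 htσ'
    · exact Finset.disjoint_left.1 (hd' σ' hσ' σ hσ hne) htσ' htσ.1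
  -- Each star exceeds its block by at most `S.card` elements.
  have hR : R.card ≤ S.card * S.card := by
    refine Finset.card_biUnion_le_card_mul _ _ _ fun σ hσ => ?_
    rw [Finset.card_sdiff_of_subset (hB σ hσ).1, hN σ hσ, (hB σ hσ).2]
    omega
  have hU : U.card = S.card * (N - S.card) := by
    rw [Finset.card_biUnion fun σ hσ σ' hσ' h => hd σ hσ σ' hσ' h,
      Finset.sum_const_nat fun σ hσ => (hB σ hσ).2]
  have hμE₁ : μ ((fun ω (t : R) => W t ω) ⁻¹' E₁) ≤ ENNReal.ofReal (S.card ^ 2 * u) := by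
    have h1 : (fun ω (t : R) => W t ω) ⁻¹' E₁ = ⋃ t ∈ R, {ω | W t ω ≤ u} := by
      ext ω; simp [E₁]
    calc _ ≤ ∑ t ∈ R, μ {ω | W t ω ≤ u} := by rw [h1]; exact measure_biUnion_finset_le _ _
      _ ≤ R.card • ENNReal.ofReal u :=
        Finset.sum_le_card_nsmul _ _ _ fun t _ => measure_ge_of_isUniform (hm t) (hunif t) u
      _ = ENNReal.ofReal (R.card * u) := by
        rw [nsmul_eq_mul, ENNReal.ofReal_mul (by positivity), ENNReal.ofReal_natCast]
      _ ≤ _ := by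
        refine ENNReal.ofReal_le_ofReal (mul_le_mul_of_nonneg_right ?_ hu0)
        rw [sq]
        exact_mod_cast hR
  have hμE₂ : μ ((fun ω (t : U) => W t ω) ⁻¹' E₂) =
      ENNReal.ofReal (((1 - l) ^ (N - S.card)) ^ S.card) := by
    have h1 : (fun ω (t : U) => W t ω) ⁻¹' E₂ = {ω | ∀ t ∈ U, l ≤ W t ω} := by
      ext ω; simp [E₂]
    rw [h1, measure_forall_le hW hm hunif, max_eq_left hl0, hU, ← pow_mul, mul_comm,
      ENNReal.ofReal_pow (by linarith)]
  have hμE : μ.real ((fun ω t => W t ω) ⁻¹' E) ≤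
      S.card ^ 2 * u * ((1 - l) ^ (N - S.card)) ^ S.card := by
    have h1l : 0 ≤ 1 - l := by linarith
    refine ENNReal.toReal_le_of_le_ofReal (by positivity) ?_
    rw [hpre, (hW.indepFun_finset R U hRU hm).measure_inter_preimage_eq_mul _ _ hE₁ hE₂, hμE₂,
      ENNReal.ofReal_mul (by positivity)]
    gcongr
  rw [← integral_sub (hint star) (hint B)]
  calc _ ≤ ∫ ω, ((fun ω t => W t ω) ⁻¹' E).indicator (fun _ => 2 * C ^ S.card) ω ∂μ := by
        refine norm_integral_le_of_norm_le ((integrable_const _).indicator hE)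
          (.of_forall fun ω => ?_)
        exact norm_prod_minOver_sub_le (fun σ hσ => (hB σ hσ).1) hBne hC hl hu fun t => W t ω
    _ = 2 * C ^ S.card * μ.real ((fun ω t => W t ω) ⁻¹' E) := by
        rw [integral_indicator_const _ hE, smul_eq_mul, mul_comm]
    _ ≤ _ := by gcongr

end Stars


/-! ### Faces and cofaces of the complete skeleton. -/

section Skeleton

variable {n d : ℕ}

noncomputable instance (i : ℕ) : Fintype (Face (completeSkeleton n d) i) := Fintype.ofFinite _

lemma face_ext {i : ℕ} {σ σ' : Face (completeSkeleton n d) i} (h : σ.1.1 = σ'.1.1) : σ = σ' :=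
  Subtype.ext (Subtype.ext h)

/-- The face spanned by a vertex set of the right cardinality. -/
def faceOf {i : ℕ} (hi : i ≤ d) (s : Finset (Fin n)) (hs : s.card = i + 1) :
    Face (completeSkeleton n d) i :=
  ⟨⟨s, Finset.card_pos.1 (by omega), by omega⟩, hs⟩

/-- The `d`-faces containing a `(d-1)`-face. -/
noncomputable def cofaces (σ : Face (completeSkeleton n d) (d - 1)) :
    Finset (Face (completeSkeleton n d) d) :=
  open Classical in Finset.univ.filter fun τ => σ.1.1 ⊆ τ.1.1

lemma mem_cofaces {σ : Face (completeSkeleton n d) (d - 1)} {τ : Face (completeSkeleton n d) d} :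
    τ ∈ cofaces σ ↔ σ.1.1 ⊆ τ.1.1 := by
  classical
  unfold cofaces
  rw [Finset.mem_filter, and_iff_right (Finset.mem_univ _)]

lemma nearestFaceDist_eq_minOver (w : completeSkeleton n d → ℝ)
    (σ : Face (completeSkeleton n d) (d - 1)) :
    nearestFaceDist w σ = minOver (cofaces σ) fun τ => w τ.1 :=
  (Equiv.subtypeEquivRight fun _ => mem_cofaces.symm).iInf_congr fun _ => rfl

lemma card_face_pred (hd : 1 ≤ d) (σ : Face (completeSkeleton n d) (d - 1)) : σ.1.1.card = d := by
  have := σ.2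
  omega

/-- The cofaces of `σ` are obtained by adding one of the `n - d` remaining vertices. -/
lemma card_cofaces (hd : 1 ≤ d) (σ : Face (completeSkeleton n d) (d - 1)) :
    (cofaces σ).card = n - d := by
  classical
  have hσ := card_face_pred hd σ
  have h1 : (cofaces σ).image (fun τ => τ.1.1) = σ.1.1ᶜ.image fun v => insert v σ.1.1 := by
    ext s
    simp only [Finset.mem_image, mem_cofaces, Finset.mem_compl]
    constructor
    · rintro ⟨τ, hτ, rfl⟩
      have h2 : (τ.1.1 \ σ.1.1).card = 1 := by
        rw [Finset.card_sdiff_of_subset hτ, hσ, τ.2]; omega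
      obtain ⟨v, hv⟩ := Finset.card_eq_one.1 h2
      have hv' : v ∈ τ.1.1 \ σ.1.1 := by rw [hv]; exact Finset.mem_singleton_self _
      refine ⟨v, (Finset.mem_sdiff.1 hv').2, ?_⟩
      rw [Finset.insert_eq, ← hv, Finset.sdiff_union_of_subset hτ]
    · rintro ⟨v, hv, rfl⟩
      exact ⟨faceOf le_rfl (insert v σ.1.1) (by rw [Finset.card_insert_of_notMem hv, hσ]),
        Finset.subset_insert _ _, rfl⟩
  rw [← Finset.card_image_of_injective (cofaces σ) (f := fun τ => τ.1.1) fun _ _ h => face_ext h,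
    h1,
    Finset.card_image_of_injOn, Finset.card_compl, hσ, Fintype.card_fin]
  intro v hv v' _ h
  have h2 : v ∈ insert v' σ.1.1 := by
    rw [← show insert v σ.1.1 = insert v' σ.1.1 from h]
    exact Finset.mem_insert_self _ _
  exact (Finset.mem_insert.1 h2).resolve_right (by simpa using hv)

/-- The union of two distinct `d`-element sets has at least `d + 1` vertices, so a common coface
must equal it. -/
lemma card_cofaces_inter_le_one (hd : 1 ≤ d) {σ σ' : Face (completeSkeleton n d) (d - 1)}
    (h : σ ≠ σ') : (cofaces σ ∩ cofaces σ').card ≤ 1 := by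
  have key : ∀ τ ∈ cofaces σ ∩ cofaces σ', σ.1.1 ∪ σ'.1.1 = τ.1.1 := by
    intro τ hτ
    rw [Finset.mem_inter, mem_cofaces, mem_cofaces] at hτ
    refine Finset.eq_of_subset_of_card_le (Finset.union_subset hτ.1 hτ.2) ?_
    rw [τ.2, Nat.succ_le_iff]
    refine lt_of_eq_of_lt (card_face_pred hd σ).symm ?_
    refine Finset.card_lt_card (Finset.subset_union_left.ssubset_of_ne fun heq => h ?_)
    refine face_ext (Finset.eq_of_subset_of_card_le ?_ ?_).symm
    · rw [heq]; exact Finset.subset_union_right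
    · rw [card_face_pred hd, card_face_pred hd]
  exact Finset.card_le_one.2 fun τ hτ τ' hτ' => face_ext ((key τ hτ).symm.trans (key τ' hτ'))

lemma card_face (hd : 1 ≤ d) :
    Fintype.card (Face (completeSkeleton n d) (d - 1)) = n.choose d := by
  have e : Face (completeSkeleton n d) (d - 1) ≃ {s : Finset (Fin n) // s.card = d} :=
    { toFun := fun σ => ⟨σ.1.1, card_face_pred hd σ⟩
      invFun := fun s => faceOf (by omega) s.1 (by rw [s.2]; omega)
      left_inv := fun _ => rfl
      right_inv := fun _ => rfl }
  rw [Fintype.card_congr e, Fintype.card_finset_len, Fintype.card_fin]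

/-- The rescaled nearest-face distance. -/
noncomputable def scaledDist (w : completeSkeleton n d → ℝ)
    (σ : Face (completeSkeleton n d) (d - 1)) : ℝ :=
  n * nearestFaceDist w σ - centering d n

lemma toMeasure_nearestFaceProcess (w : completeSkeleton n d → ℝ) :
    (nearestFaceProcess w).toMeasure = ∑ σ, Measure.dirac (scaledDist w σ) := by
  change Measure.sum (fun σ => Measure.dirac
    (n * nearestFaceDist w σ - d * Real.log n + Real.log d.factorial)) = _
  rw [Measure.sum_fintype]
  refine Finset.sum_congr rfl fun σ _ => congrArg Measure.dirac ?_
  rw [scaledDist, centering]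
  ring

variable {Ω : Type*} [MeasurableSpace Ω] {μ : Measure Ω} {w : completeSkeleton n d → Ω → ℝ}

lemma IsUniformlyWeighted.measurable_scaledDist (hw : IsUniformlyWeighted n d w μ)
    (σ : Face (completeSkeleton n d) (d - 1)) :
    Measurable fun ω => scaledDist (fun τ => w τ ω) σ := by
  simp only [scaledDist, nearestFaceDist_eq_minOver]
  have := (measurable_minOver (cofaces σ)).comp (measurable_pi_lambda _ hw.measurable)
  exact (this.const_mul _).sub_const _

lemma IsUniformlyWeighted.measurable_nearestFaceProcess (hw : IsUniformlyWeighted n d w μ) :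
    Measurable fun ω => nearestFaceProcess fun τ => w τ ω := by
  refine PointMeasure.measurable_of_measurable_toMeasure ?_
  simp_rw [toMeasure_nearestFaceProcess]
  refine Measure.measurable_of_measurable_coe _ fun A hA => ?_
  simp only [Measure.finsetSum_apply]
  exact Finset.measurable_fun_sum _ fun σ _ => (Measure.measurable_coe hA).comp
    (Measure.measurable_dirac.comp (hw.measurable_scaledDist σ))

/-- The joint moment of `k` rescaled nearest-face distances is close to that of `k` independent
minima of `n - d - k` uniform variables. -/
lemma IsUniformlyWeighted.norm_integral_prod_sub_le [IsProbabilityMeasure μ]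
    (hw : IsUniformlyWeighted n d w μ) (hd : 1 ≤ d)
    (S : Finset (Face (completeSkeleton n d) (d - 1))) (hk : S.card < n - d)
    {g : ℝ → ℂ} (hg : Measurable g) {C K : ℝ} (hC : ∀ x, ‖g x‖ ≤ C)
    (hgK : ∀ x, K < |x| → g x = 0) (hl0 : 0 ≤ (-K + centering d n) / n)
    (hl1 : (-K + centering d n) / n ≤ 1) (hu0 : 0 ≤ (K + centering d n) / n) :
    ‖∫ ω, ∏ σ ∈ S, g (scaledDist (fun τ => w τ ω) σ) ∂μ -
        (∫ x, (minDensity (n - (d + S.card)) x : ℂ) * g (n * x - centering d n)) ^ S.card‖ ≤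
      2 * C ^ S.card * (S.card ^ 2 * ((K + centering d n) / n) *
        ((1 - (-K + centering d n) / n) ^ (n - (d + S.card))) ^ S.card) := by
  classical
  have hn : (0 : ℝ) < n := by
    have : 0 < n := by omega
    exact_mod_cast this
  simp only [scaledDist, nearestFaceDist_eq_minOver]
  rw [← Nat.sub_sub]
  -- The cut-offs `l` and `u` are the preimages of `-K` and `K` under `x ↦ n x - centering d n`.
  refine norm_integral_prod_minOver_sub_le (star := cofaces)
    (G := fun x => g (n * x - centering d n)) hw.indep hw.measurable hw.uniform
    (fun σ _ => card_cofaces hd σ) (fun σ _ σ' _ h => card_cofaces_inter_le_one hd h) hk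
    (by fun_prop)
    (fun x => hC _) (fun x hx => hgK _ ?_) (fun x hx => hgK _ ?_) hl0 hl1 hu0
  · rw [lt_div_iff₀ hn] at hx
    exact lt_of_lt_of_le (by linarith) (neg_le_abs _)
  · rw [div_lt_iff₀ hn] at hx
    exact lt_of_lt_of_le (by linarith) (le_abs_self _)

end Skeleton


/-! ### Convergence of factorial moments and of the characteristic functional. -/

lemma tendsto_choose_div_pow (k : ℕ) :
    Tendsto (fun n : ℕ => (n.choose k : ℝ) / n ^ k) atTop (𝓝 (1 / k.factorial)) := by
  have hk : (k.factorial : ℝ) ≠ 0 := by exact_mod_cast k.factorial_ne_zero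
  have h0 : ∀ᶠ n : ℕ in atTop, ((n : ℝ) ^ k / k.factorial) ≠ 0 := by
    filter_upwards [eventually_ge_atTop 1] with n hn
    have : (n : ℝ) ≠ 0 := by exact_mod_cast (by omega : n ≠ 0)
    positivity
  have h := ((Asymptotics.isEquivalent_iff_tendsto_one h0).1 (isEquivalent_choose k)).mul_const
    (1 / (k.factorial : ℝ))
  rw [one_mul] at h
  refine h.congr fun n => ?_
  simp only [Pi.div_apply]
  field_simp

/-- This counts the `k`-sets of `(d-1)`-faces. The factor `(1 / d!)^k` cancels the `d!` contributed
by each rescaled minimum. -/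
lemma tendsto_choose_choose_div_pow {d : ℕ} (hd : 1 ≤ d) (k : ℕ) :
    Tendsto (fun n : ℕ => ((n.choose d).choose k : ℝ) / ((n : ℝ) ^ d) ^ k) atTop
      (𝓝 (1 / k.factorial * (1 / d.factorial) ^ k)) := by
  have hchoose : Tendsto (fun n : ℕ => n.choose d) atTop atTop := by
    refine tendsto_atTop_mono' _ ?_ (tendsto_sub_atTop_nat d)
    filter_upwards [eventually_ge_atTop d] with n hn
    calc n - d ≤ (n - d + 1).choose (n - d) := by rw [Nat.choose_succ_self_right]; omega
      _ ≤ n.choose (n - d) := Nat.choose_le_choose _ (by omega)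
      _ = n.choose d := Nat.choose_symm hn
  have h := ((tendsto_choose_div_pow k).comp hchoose).mul ((tendsto_choose_div_pow d).pow k)
  refine h.congr' ?_
  filter_upwards [hchoose.eventually_ge_atTop 1] with n hn
  have : ((n.choose d : ℕ) : ℝ) ≠ 0 := by exact_mod_cast (by omega : n.choose d ≠ 0)
  simp only [Function.comp_apply, div_pow]
  field_simp

section

variable {d : ℕ} {Ω : ℕ → Type*} [∀ n, MeasurableSpace (Ω n)] {μ : ∀ n, Measure (Ω n)}
  [∀ n, IsProbabilityMeasure (μ n)] {w : ∀ n, completeSkeleton n d → Ω n → ℝ}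

lemma IsUniformlyWeighted.integrable_prod {n : ℕ} (hw : IsUniformlyWeighted n d (w n) (μ n))
    (S : Finset (Face (completeSkeleton n d) (d - 1))) {g : ℝ → ℂ} (hg : Measurable g) {C : ℝ}
    (hC : ∀ x, ‖g x‖ ≤ C) :
    Integrable (fun ω => ∏ σ ∈ S, g (scaledDist (fun τ => w n τ ω) σ)) (μ n) := by
  refine Integrable.of_bound (C := C ^ S.card) ?_ (ae_of_all _ fun ω => ?_)
  · exact (Finset.measurable_fun_prod _ fun σ _ =>
      hg.comp (hw.measurable_scaledDist σ)).aestronglyMeasurable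
  · rw [norm_prod]
    exact (Finset.prod_le_prod (fun _ _ => norm_nonneg _) fun _ _ => hC _).trans_eq
      (Finset.prod_const _)

/-- The factorial moments of the rescaled nearest-face distances converge to those of a Poisson
process with intensity `exp (-y) dy`. -/
lemma tendsto_integral_sum_powersetCard (hd : 1 ≤ d)
    (hw : ∀ n, IsUniformlyWeighted n d (w n) (μ n)) {g : ℝ → ℂ} (hg : Continuous g)
    (hcs : HasCompactSupport g) (k : ℕ) :
    Tendsto (fun n => ∫ ω, ∑ S ∈ Finset.univ.powersetCard k,
        ∏ σ ∈ S, g (scaledDist (fun τ => w n τ ω) σ) ∂μ n) atTop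
      (𝓝 ((∫ y, (Real.exp (-y) : ℂ) * g y) ^ k / k.factorial)) := by
  obtain ⟨C, hC⟩ := hcs.exists_bound_of_continuous hg
  obtain ⟨K, hK⟩ := hcs.isCompact.isBounded.exists_norm_le
  have hgK : ∀ x, K < |x| → g x = 0 := fun x hx => by
    by_contra h
    exact absurd (hK x (subset_tsupport _ h)) (not_le.2 hx)
  have hdf : (d.factorial : ℂ) ≠ 0 := by exact_mod_cast d.factorial_ne_zero
  set a : ℕ → ℂ := fun n => ∫ x, (minDensity (n - (d + k)) x : ℂ) * g (n * x - centering d n)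
  -- Main term: the number of `k`-sets times the value for `k` independent minima.
  have ha : Tendsto (fun n : ℕ => (((n.choose d).choose k : ℝ) : ℂ) * a n ^ k) atTop
      (𝓝 ((∫ y, (Real.exp (-y) : ℂ) * g y) ^ k / k.factorial)) := by
    have h1 := (Complex.continuous_ofReal.tendsto _).comp (tendsto_choose_choose_div_pow hd k)
    have h2 := h1.mul ((tendsto_pow_mul_integral_minDensity hd (d + k) hg hcs).pow k)
    have h3 : ((1 / k.factorial * (1 / d.factorial) ^ k : ℝ) : ℂ) *
        (d.factorial * ∫ y, (Real.exp (-y) : ℂ) * g y) ^ k =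
        (∫ y, (Real.exp (-y) : ℂ) * g y) ^ k / k.factorial := by
      push_cast
      rw [mul_pow, one_div, one_div, inv_pow, mul_assoc,
        inv_mul_cancel_left₀ (pow_ne_zero _ hdf), inv_mul_eq_div]
    rw [h3] at h2
    refine h2.congr' ?_
    filter_upwards [eventually_ge_atTop 1] with n hn
    have hn0 : (n : ℂ) ≠ 0 := by exact_mod_cast (by omega : n ≠ 0)
    simp only [Function.comp_apply, a]
    push_cast
    rw [mul_pow]
    field_simp
  -- Error term: the number of `k`-sets is of order `n^{dk}`, which the power of `1 - l`
  -- compensates, and the remaining factor `(K + centering d n) / n` tends to zero.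
  have hb : Tendsto (fun n : ℕ => ((n.choose d).choose k : ℝ) * (2 * C ^ k * (k ^ 2 *
      ((K + centering d n) / n) * ((1 - (-K + centering d n) / n) ^ (n - (d + k))) ^ k)))
      atTop (𝓝 0) := by
    have h2 := (((tendsto_choose_choose_div_pow hd k).mul
      ((tendsto_pow_mul_one_sub_pow d (d + k) (-K)).pow k)).mul
      (tendsto_centering_div d K)).const_mul (2 * C ^ k * k ^ 2)
    rw [mul_zero, mul_zero] at h2
    refine h2.congr' ?_
    filter_upwards [eventually_ge_atTop 1] with n hn
    have hn0 : (n : ℝ) ≠ 0 := by exact_mod_cast (by omega : n ≠ 0)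
    rw [mul_pow ((n : ℝ) ^ d)]
    generalize ((1 - (-K + centering d n) / n) ^ (n - (d + k))) ^ k = b
    generalize (K + centering d n) / n = u
    field_simp
  refine (tendsto_iff_of_dist ?_).1 ha
  refine squeeze_zero' (Eventually.of_forall fun n => dist_nonneg) ?_ hb
  filter_upwards [eventually_ge_atTop (d + k + 1), eventually_centering_nonneg hd (-K),
    eventually_centering_nonneg hd K,
    (tendsto_centering_div d (-K)).eventually_le_const zero_lt_one] with n hn hl0 hu0 hl1
  have hcard : (Finset.univ.powersetCard k :
      Finset (Finset (Face (completeSkeleton n d) (d - 1)))).card = (n.choose d).choose k := by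
    rw [Finset.card_powersetCard, Finset.card_univ, card_face hd]
  rw [integral_finsetSum _ fun S _ => (hw n).integrable_prod S hg.measurable hC, dist_comm,
    dist_eq_norm, Complex.ofReal_natCast, ← hcard, ← nsmul_eq_mul, ← Finset.sum_const,
    ← Finset.sum_sub_distrib, ← nsmul_eq_mul, ← Finset.sum_const]
  refine norm_sum_le_of_le _ fun S hS => ?_
  have hSk := (Finset.mem_powersetCard.1 hS).2
  have := (hw n).norm_integral_prod_sub_le hd S (by omega) hg.measurable hC hgK hl0 hl1 hu0
  rwa [hSk] at this

lemma integral_nearestFaceProcess {n : ℕ} (w : completeSkeleton n d → ℝ) (f : ℝ → ℝ) :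
    ∫ x, f x ∂(nearestFaceProcess w).toMeasure = ∑ σ, f (scaledDist w σ) := by
  rw [toMeasure_nearestFaceProcess, integral_finsetSum_measure fun σ _ =>
    integrable_dirac (by simp)]
  simp

/-- The characteristic functional of the nearest-face process converges to that of a Poisson
process with intensity `exp (-y) dy`. -/
lemma tendsto_charFunctional_nearestFaceProcess (hd : 1 ≤ d)
    (hw : ∀ n, IsUniformlyWeighted n d (w n) (μ n)) {f : ℝ → ℝ} (hf : Continuous f)
    (hcs : HasCompactSupport f) :
    Tendsto (fun n => ∫ ω, Complex.exp ((∫ x, f x ∂(nearestFaceProcess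
        fun σ => w n σ ω).toMeasure : ℝ) * Complex.I) ∂μ n) atTop
      (𝓝 (Complex.exp (∫ y, (Real.exp (-y) : ℂ) * (Complex.exp (f y * Complex.I) - 1)))) := by
  set g : ℝ → ℂ := fun y => Complex.exp (f y * Complex.I) - 1
  have hg : Continuous g := by fun_prop
  have hgcs : HasCompactSupport g :=
    hcs.comp_left (g := fun y : ℝ => Complex.exp (y * Complex.I) - 1) (by simp)
  -- The norm of `g` governs the Bonferroni remainder; it is kept complex-valued so that the same
  -- moment limit applies to it.
  set g' : ℝ → ℂ := fun y => (‖g y‖ : ℂ)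
  have hg' : Continuous g' := by fun_prop
  have hgcs' : HasCompactSupport g' :=
    hgcs.comp_left (g := fun z : ℂ => (‖z‖ : ℂ)) (by simp)
  have hg1 : ∀ y, ‖1 + g y‖ ≤ 1 := fun y => by
    simp [g, Complex.norm_exp_ofReal_mul_I]
  obtain ⟨C, hC⟩ := hgcs.exists_bound_of_continuous hg
  have hC' : ∀ x, ‖g' x‖ ≤ C := fun x => by simpa [g'] using hC x
  set J : ℂ := ∫ y, (Real.exp (-y) : ℂ) * g y
  set J' : ℂ := ∫ y, (Real.exp (-y) : ℂ) * g' y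
  have hexp (n : ℕ) (ω : Ω n) : Complex.exp ((∫ x, f x ∂(nearestFaceProcess
      fun σ => w n σ ω).toMeasure : ℝ) * Complex.I) =
      ∏ σ, (1 + g (scaledDist (fun τ => w n τ ω) σ)) := by
    rw [integral_nearestFaceProcess, Complex.ofReal_sum, Finset.sum_mul,
      Complex.exp_sum]
    simp [g]
  simp only [hexp]
  have hmain : ∀ k n, ‖∫ ω, ∏ σ, (1 + g (scaledDist (fun τ => w n τ ω) σ)) ∂μ n -
      ∑ j ∈ Finset.range k, ∫ ω, ∑ S ∈ Finset.univ.powersetCard j,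
        ∏ σ ∈ S, g (scaledDist (fun τ => w n τ ω) σ) ∂μ n‖ ≤
      ‖∫ ω, ∑ S ∈ Finset.univ.powersetCard k,
        ∏ σ ∈ S, g' (scaledDist (fun τ => w n τ ω) σ) ∂μ n‖ := by
    intro k n
    have hi (j : ℕ) : Integrable (fun ω => ∑ S ∈ Finset.univ.powersetCard j,
        ∏ σ ∈ S, g (scaledDist (fun τ => w n τ ω) σ)) (μ n) :=
      integrable_finsetSum _ fun S _ => (hw n).integrable_prod S hg.measurable hC
    have hi' : Integrable (fun ω => ∑ S ∈ Finset.univ.powersetCard k,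
        ∏ σ ∈ S, ‖g (scaledDist (fun τ => w n τ ω) σ)‖) (μ n) := by
      have := (integrable_finsetSum (Finset.univ.powersetCard k) fun S _ =>
        (hw n).integrable_prod S hg'.measurable hC').re
      refine this.congr (ae_of_all _ fun ω => ?_)
      simp only [g', ← Complex.ofReal_prod, ← Complex.ofReal_sum]
      exact Complex.ofReal_re _
    have hi0 := (hw n).integrable_prod Finset.univ (g := fun y => 1 + g y)
      (by fun_prop) hg1
    rw [← integral_finsetSum _ fun j _ => hi j,
      ← integral_sub hi0 (integrable_finsetSum _ fun j _ => hi j)]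
    simp only [g', ← Complex.ofReal_prod, ← Complex.ofReal_sum]
    rw [integral_complex_ofReal, Complex.norm_real]
    refine (norm_integral_le_of_norm_le hi' (ae_of_all _ fun ω => ?_)).trans (le_abs_self _)
    exact norm_prod_one_add_sub_le _ (fun _ => hg1 _) k
  refine Metric.tendsto_atTop'.2 ?_
  intro ε hε
  have h1 : Tendsto (fun k : ℕ => ∑ j ∈ Finset.range k, J ^ j / j.factorial) atTop
      (𝓝 (Complex.exp J)) := by
    rw [Complex.exp_eq_exp_ℂ]
    exact (NormedSpace.expSeries_div_hasSum_exp J).tendsto_sum_nat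
  have h2 : Tendsto (fun k : ℕ => J' ^ k / k.factorial) atTop (𝓝 0) :=
    (NormedSpace.expSeries_div_summable J').tendsto_atTop_zero
  -- The order `k` is fixed before `n`. One quarter of `ε` goes to the tail of the exponential
  -- series, one to the limiting remainder `J'^k / k!`, and for large `n` one each to the
  -- convergence of the truncated sum and of the remainder.
  obtain ⟨k, hk1, hk2⟩ := ((Metric.tendsto_nhds.1 h1 (ε / 4) (by positivity)).and
    (Metric.tendsto_nhds.1 h2 (ε / 4) (by positivity))).exists
  have h3 := Metric.tendsto_nhds.1 (tendsto_finsetSum (Finset.range k) fun j _ =>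
    tendsto_integral_sum_powersetCard hd hw hg hgcs j) (ε / 4) (by positivity)
  have h4 := Metric.tendsto_nhds.1 (tendsto_integral_sum_powersetCard hd hw hg' hgcs' k)
    (ε / 4) (by positivity)
  obtain ⟨n₀, hn₀⟩ := eventually_atTop.1 (h3.and h4)
  refine ⟨n₀, fun n hn => ?_⟩
  obtain ⟨h5, h6⟩ := hn₀ n hn.le
  have h7 := hmain k n
  rw [← dist_eq_norm] at h7
  rw [dist_zero_right] at hk2
  rw [dist_eq_norm] at h6
  have h8 := norm_le_norm_add_norm_sub' (∫ ω, ∑ S ∈ Finset.univ.powersetCard k,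
        ∏ σ ∈ S, g' (scaledDist (fun τ => w n τ ω) σ) ∂μ n) (J' ^ k / k.factorial)
  refine (dist_triangle4 _ _ _ _).trans_lt (lt_of_lt_of_le (add_lt_add
    (add_lt_add_of_le_of_lt h7 h5) hk1) ?_)
  linarith

end

/-! ### The limit theorem. -/

instance isLocallyFiniteMeasure_withDensity_exp_neg :
    IsLocallyFiniteMeasure (volume.withDensity fun x : ℝ => ENNReal.ofReal (Real.exp (-x))) :=
  IsLocallyFiniteMeasure.withDensity_ofReal (by fun_prop)

theorem theorem4p2 (d : ℕ) (hd : 1 ≤ d) :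
    (∃ π : ProbabilityMeasure PointMeasure,
      IsPoissonPointProcess (fun m : PointMeasure => m) (π : Measure PointMeasure)
        (fun x => Real.exp (-x))) ∧
    ∀ (Ω : ℕ → Type*) [∀ n, MeasurableSpace (Ω n)] (μ : ∀ n, Measure (Ω n))
      [∀ n, IsProbabilityMeasure (μ n)] (w : ∀ n, completeSkeleton n d → Ω n → ℝ)
      (_hw : ∀ n, IsUniformlyWeighted n d (w n) (μ n))
      (Ω' : Type*) [MeasurableSpace Ω'] (μ' : Measure Ω') [IsProbabilityMeasure μ']
      (P : Ω' → PointMeasure)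
      (_hP : IsPoissonPointProcess P μ' (fun x => Real.exp (-x))),
      TendstoInDistribution (fun n ω => nearestFaceProcess (fun σ => w n σ ω)) atTop P μ μ' := by
  refine ⟨exists_isPoissonPointProcess _, fun Ω _ μ _ w hw Ω' _ μ' _ P hP => ?_⟩
  refine PointMeasure.tendstoInDistribution_of_charFunctional
    (fun n => IsUniformlyWeighted.measurable_nearestFaceProcess (hw n))
    hP.measurable fun f hf hcs => ?_
  rw [hP.integral_exp_integral hf hcs,
    integral_withDensity_eq_integral_toReal_smul (by fun_prop) (by simp)]
  convert tendsto_charFunctional_nearestFaceProcess hd hw hf hcs using 5 with y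
  rw [ENNReal.toReal_ofReal (Real.exp_pos _).le, Complex.real_smul]
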